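/- Let $\gamma=(\gamma_t)_{t\ge 0}$ be the (kinetic) prudent walk on $\mathbb{Z}^2$: $\gamma_0=(0,0)$ and, given $\gamma_0,\dots,\gamma_t$, the next site $\gamma_{t+1}$ is chosen uniformly among the neighbours $\gamma_t+\vec e$, $\vec e\in\{\pm\vec e_1,\pm\vec e_2\}$, whose direction is allowed, i.e. satisfies $\{\gamma_t+k\vec e: k>0\}\cap\{\gamma_0,\dots,\gamma_t\}=\varnothing$. Let $\mathcal R_t$ be the bounding rectangle of $\{\gamma_0,\dots,\gamma_t\}$. The path visits a given corner (lower left, lower right, upper left or upper right) at time $t$ if $\gamma_t$ is that corner of $\mathcal R_t$. Exchanging the two coordinates if the first step is vertical, regard the first step as horizontal, and let $\mathcal W_t$ and $\mathcal H_t$ be the numbers of distinct first, respectively second, coordinates of $\gamma_0,\dots,\gamma_t$. Put $T_0=0$, $U_0=\inf\{t>0:\mathcal H_t>1\}-1$ and, for $k\ge 0$, \[ T_{k+1}=\inf\{t>U_k:\mathcal W_t>\mathcal W_{t-1}\}-1,\qquad U_{k+1}=\inf\{t>T_{k+1}:\mathcal H_t>\mathcal H_{t-1}\}-1 , \] with $\inf\varnothing=\infty$.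 Let $A_k$ be the event that the $k$th excursion crosses a side of the rectangle, that is: $T_k,U_k<\infty$ and the walk is at a bottom (resp. top) corner of $\mathcal R_{T_k}$ at time $T_k$ and at a top (resp. bottom) corner of $\mathcal R_{U_k}$ at time $U_k$; or $U_k,T_{k+1}<\infty$ and the walk is at a right (resp. left) corner of $\mathcal R_{U_k}$ at time $U_k$ and at a left (resp. right) corner of $\mathcal R_{T_{k+1}}$ at time $T_{k+1}$. Then there is a constant $C>0$ such that \[ P(A_k)\le \frac{C}{k^{4/3}}\qquad\text{for all large enough } k . \] Moreover $P(\limsup_k A_k)=0$, and almost surely exactly one of the four corners is visited infinitely many times. -/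

import Mathlib

open MeasureTheory Filter

namespace PrudentWalk

/-- A (deterministic) trajectory in `ℤ²`. -/
abbrev Path := ℕ → ℤ × ℤ

/-- The four lattice directions `±e₁`, `±e₂`. -/
def directions : Finset (ℤ × ℤ) := {(1, 0), (-1, 0), (0, 1), (0, -1)}

open Classical in
/-- The directions allowed after time `t`: those `e` for which the half-line
`{p t + k e : k > 0}` contains none of the sites `p 0, …, p t`. -/
noncomputable def allowedDirs (p : Path) (t : ℕ) : Finset (ℤ × ℤ) :=
  directions.filter fun e => ∀ k : ℕ, 0 < k → ∀ s ≤ t, p t + k • e ≠ p s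

/-- The event that the process `γ` follows the path `p` on the time interval `{0, …, t}`. -/
def follows {Ω : Type*} (γ : ℕ → Ω → ℤ × ℤ) (p : Path) (t : ℕ) : Set Ω :=
  {ω | ∀ s ≤ t, γ s ω = p s}

/-- `γ` is a (kinetic) prudent walk under `P`: it starts at the origin and, given its past
`γ 0, …, γ t`, its next step is uniform among the allowed directions. -/
structure IsPrudentWalk {Ω : Type*} [MeasurableSpace Ω] (P : Measure Ω)
    (γ : ℕ → Ω → ℤ × ℤ) : Prop where
  measurable : ∀ t, Measurable (γ t)
  start : ∀ᵐ ω ∂P, γ 0 ω = (0, 0)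
  step : ∀ (t : ℕ) (p : Path) (e : ℤ × ℤ),
    P (follows γ p t ∩ {ω | γ (t + 1) ω = p t + e}) =
      if e ∈ allowedDirs p t then P (follows γ p t) / ((allowedDirs p t).card : ENNReal) else 0

/-- The first coordinates of the sites visited up to time `t`. -/
def xs (p : Path) (t : ℕ) : Finset ℤ := (Finset.range (t + 1)).image fun s => (p s).1

/-- The second coordinates of the sites visited up to time `t`. -/
def ys (p : Path) (t : ℕ) : Finset ℤ := (Finset.range (t + 1)).image fun s => (p s).2

theorem xs_nonempty (p : Path) (t : ℕ) : (xs p t).Nonempty :=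
  Finset.Nonempty.image ⟨0, by simp⟩ _

theorem ys_nonempty (p : Path) (t : ℕ) : (ys p t).Nonempty :=
  Finset.Nonempty.image ⟨0, by simp⟩ _

/-- The width, in lattice sites, of the bounding rectangle at time `t`. -/
def width (p : Path) (t : ℕ) : ℕ := (xs p t).card

/-- The height, in lattice sites, of the bounding rectangle at time `t`. -/
def height (p : Path) (t : ℕ) : ℕ := (ys p t).card

/-- Labels of the four corners of a rectangle. The first component tells whether the corner is
on the right (`true`) or on the left (`false`), the second one whether it is at the top (`true`)
or at the bottom (`false`). -/
abbrev Corner := Bool × Bool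

/-- The position of the corner `c` of the bounding rectangle of `p 0, …, p t`. -/
def cornerPos (p : Path) (t : ℕ) (c : Corner) : ℤ × ℤ :=
  (if c.1 then (xs p t).max' (xs_nonempty p t) else (xs p t).min' (xs_nonempty p t),
   if c.2 then (ys p t).max' (ys_nonempty p t) else (ys p t).min' (ys_nonempty p t))

/-- At time `t`, the path is at the corner `c` of its current bounding rectangle. -/
def VisitsCorner (p : Path) (t : ℕ) (c : Corner) : Prop := p t = cornerPos p t c

/-- At time `t`, the path is at one of the two right (`b = true`) or left (`b = false`) corners
of its current bounding rectangle. -/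
def AtHorizontalEnd (p : Path) (t : ℕ) (b : Bool) : Prop := ∃ c : Bool, VisitsCorner p t (b, c)

/-- At time `t`, the path is at one of the two top (`b = true`) or bottom (`b = false`) corners
of its current bounding rectangle. -/
def AtVerticalEnd (p : Path) (t : ℕ) (b : Bool) : Prop := ∃ c : Bool, VisitsCorner p t (c, b)

/-- The infimum of a set of times, equal to `⊤` if the set is empty. -/
noncomputable def firstTime (S : Set ℕ) : ℕ∞ := sInf ((fun t : ℕ => (t : ℕ∞)) '' S)

/-- The pair `(T k, U k)` of times delimiting the excursions of a path with horizontal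
first step. -/
noncomputable def excTimes (p : Path) : ℕ → ℕ∞ × ℕ∞
  | 0 => (0, firstTime {t | 0 < t ∧ 1 < height p t} - 1)
  | k + 1 =>
    let T : ℕ∞ := firstTime {t | (excTimes p k).2 < (t : ℕ∞) ∧ width p (t - 1) < width p t} - 1
    (T, firstTime {t | T < (t : ℕ∞) ∧ height p (t - 1) < height p t} - 1)

/-- `T k`: the start of the `k`-th vertical excursion (possibly `⊤`). -/
noncomputable def timeT (p : Path) (k : ℕ) : ℕ∞ := (excTimes p k).1

/-- `U k`: the end of the `k`-th vertical excursion (possibly `⊤`). -/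
noncomputable def timeU (p : Path) (k : ℕ) : ℕ∞ := (excTimes p k).2

/-- The `k`-th vertical excursion, on `(T k, U k]`, goes from a bottom corner to a top corner or
conversely. -/
def CrossesVertically (p : Path) (k : ℕ) : Prop :=
  ∃ t u : ℕ, timeT p k = t ∧ timeU p k = u ∧
    ∃ b : Bool, AtVerticalEnd p t b ∧ AtVerticalEnd p u (!b)

/-- The `k`-th horizontal excursion, on `(U k, T (k + 1)]`, goes from a right corner to a left
corner or conversely. -/
def CrossesHorizontally (p : Path) (k : ℕ) : Prop :=
  ∃ u t : ℕ, timeU p k = u ∧ timeT p (k + 1) = t ∧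
    ∃ b : Bool, AtHorizontalEnd p u b ∧ AtHorizontalEnd p t (!b)

/-- The path itself if its first step is horizontal, and its image under the exchange of the two
coordinates if its first step is vertical. -/
def orient (p : Path) : Path := fun t =>
  if p 1 = (0, 1) ∨ p 1 = (0, -1) then (p t).swap else p t

/-- The event `A k` that the `k`-th excursion crosses a side of the bounding rectangle, the
excursions being those of the path with axes named so that the first step is horizontal. -/
def crossing {Ω : Type*} (γ : ℕ → Ω → ℤ × ℤ) (k : ℕ) : Set Ω :=
  {ω | CrossesVertically (orient fun t => γ t ω) k ∨
    CrossesHorizontally (orient fun t => γ t ω) k}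

end PrudentWalk

/-! After its first step, a prudent walk stands on a side of its bounding rectangle and can never
step inwards. Up to lattice symmetries it is therefore a Markov chain on a few numbers
(`SideState`): excursion index, lengths `L` of the current side and `M` of the other ones, distance
to the corner where the excursion began, heading. During an excursion the walk moves symmetrically
along a side of fixed length `L` while `M` grows; going past an end of the side starts the next
excursion, with the two lengths exchanged. A crossing in the `k`th excursion, `k ≥ 1`, forces the
chain to reach the far end of its side in excursion `2k` or `2k + 1`.

By a gambler's ruin estimate, an excursion reaches the far end of a side of length `L` with
probability at most `2 / L`, so it suffices that the sides be long. Fix `m`. Once all sides have at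
least `m` sites, each excursion has probability at least `κ / m` of lasting until `M ≥ m ^ 2`: a
walk started near a corner gets to distance of order `m` with probability of order `1 / m`, and then
survives for about `m ^ 2` lines. The excursions before the `J`th that lengthen its side offer about
`(J - 2 * m) / 2` trials, whence the bound `2 / m ^ 2 + (1 - κ / m) ^ ((J - 2 * m) / 2)`. With `m`
of order `J ^ (2/3)` the first term is of order `J ^ (-4/3)` and the second is exponentially small
in `J ^ (1/3)`.

These estimates come from explicit supermartingales: linear (`crossPotential`), built on a sine
(`lasting`), and their combination `farPotential`, fed to `measure_exists_stateAt_le`.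
Borel–Cantelli then leaves finitely many crossings. A parabolic potential (`durationPotential`)
shows that no excursion lasts forever. When far ends are no longer reached, every new excursion
turns around the same corner, which is thus visited infinitely often while the others are not
(`Run.existsUnique_corner`). -/

namespace PrudentWalk

/-! ### One-step expectations and supermartingales of the prudent walk. -/

/-- `G` depends only on the path up to time `t`. -/
def DeterminedBy {X : Type*} (G : Path → X) (t : ℕ) : Prop :=
  ∀ p q : Path, (∀ s ≤ t, p s = q s) → G p = G q

/-- The path `p` up to time `t`, followed by the step `e`. -/
def extend (p : Path) (t : ℕ) (e : ℤ × ℤ) : Path := fun s => if s ≤ t then p s else p t + e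

theorem extend_of_le (p : Path) {t s : ℕ} (e : ℤ × ℤ) (h : s ≤ t) : extend p t e s = p s := by
  simp [extend, h]

theorem extend_succ (p : Path) (t : ℕ) (e : ℤ × ℤ) : extend p t e (t + 1) = p t + e := by
  simp [extend]

/-- All steps of `p` before time `t` are allowed. -/
def PrudentUpTo (p : Path) (t : ℕ) : Prop :=
  p 0 = (0, 0) ∧ ∀ s < t, p (s + 1) - p s ∈ allowedDirs p s

theorem allowedDirs_congr {p q : Path} {t : ℕ} (h : ∀ s ≤ t, p s = q s) :
    allowedDirs p t = allowedDirs q t := by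
  ext e
  simp only [allowedDirs, Finset.mem_filter]
  refine and_congr_right fun _ => forall_congr' fun k => imp_congr_right fun _ =>
    forall_congr' fun s => ?_
  constructor <;> intro H hs
  · rw [← h s hs, ← h t le_rfl]; exact H hs
  · rw [h s hs, h t le_rfl]; exact H hs

theorem extend_congr {p q : Path} {t : ℕ} (e : ℤ × ℤ) (h : ∀ s ≤ t, p s = q s) :
    extend p t e = extend q t e := by
  funext s
  by_cases hs : s ≤ t
  · simp [extend, hs, h s hs]
  · simp [extend, hs, h t le_rfl]

/-- The path with prescribed initial segment, continued by zero. -/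
def ofPrefix (t : ℕ) (π : Fin (t + 1) → ℤ × ℤ) : Path :=
  fun s => if h : s < t + 1 then π ⟨s, h⟩ else 0

section Walk

variable {Ω : Type*} [MeasurableSpace Ω] {P : Measure Ω} {γ : ℕ → Ω → ℤ × ℤ}

theorem IsPrudentWalk.measurable_prefix (hγ : IsPrudentWalk P γ) (t : ℕ) :
    Measurable fun ω => (fun i : Fin (t + 1) => γ i ω) :=
  measurable_pi_lambda _ fun i => hγ.measurable i

theorem IsPrudentWalk.measurable_comp {X : Type*} [MeasurableSpace X] (hγ : IsPrudentWalk P γ)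
    {G : Path → X} {t : ℕ} (hG : DeterminedBy G t) : Measurable fun ω => G fun s => γ s ω := by
  have : (fun ω => G fun s => γ s ω) =
      (fun π : Fin (t + 1) → ℤ × ℤ => G (ofPrefix t π)) ∘
        fun ω => (fun i : Fin (t + 1) => γ i ω) := by
    funext ω
    refine hG _ _ fun s hs => ?_
    simp [ofPrefix, Nat.lt_succ_of_le hs]
  rw [this]
  exact (measurable_of_countable _).comp (hγ.measurable_prefix t)

/-- This is the Markov property in integrated form, without conditional expectations: there are
countably many prefixes of length `t + 1`, and on each piece of this partition the law of the next
step is given by `step`. -/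
theorem IsPrudentWalk.lintegral_step (hγ : IsPrudentWalk P γ) {G : Path → ENNReal} {t : ℕ}
    (hG : DeterminedBy G (t + 1)) :
    ∫⁻ ω, G (fun s => γ s ω) ∂P =
      ∫⁻ ω, (∑ e ∈ allowedDirs (fun s => γ s ω) t, G (extend (fun s => γ s ω) t e)) /
        ((allowedDirs (fun s => γ s ω) t).card : ENNReal) ∂P := by
  classical
  let pf : Ω → (Fin (t + 1) → ℤ × ℤ) := fun ω i => γ i ω
  have hpf : Measurable pf := hγ.measurable_prefix t
  have hfol : ∀ π, pf ⁻¹' {π} = follows γ (ofPrefix t π) t := by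
    intro π
    ext ω
    simp only [Set.mem_preimage, Set.mem_singleton_iff, follows, Set.mem_ofPred_eq, pf]
    constructor
    · rintro rfl s hs
      simp [ofPrefix, Nat.lt_succ_of_le hs]
    · intro h
      funext i
      have := h i (Nat.le_of_lt_succ i.2)
      simpa [ofPrefix, Nat.le_of_lt_succ i.2] using this
  have hmeas : ∀ π, MeasurableSet (pf ⁻¹' {π}) := fun π => hpf (measurableSet_singleton π)
  have hdisj : Pairwise (Function.onFun Disjoint fun π => pf ⁻¹' {π}) := by
    intro a b hab
    exact Disjoint.preimage _ (by simpa using hab)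
  have hun : (⋃ π, pf ⁻¹' {π}) = Set.univ := by
    ext ω; simp
  have key : ∀ f : Ω → ENNReal, ∫⁻ ω, f ω ∂P = ∑' π, ∫⁻ ω in pf ⁻¹' {π}, f ω ∂P := by
    intro f
    rw [← lintegral_iUnion hmeas hdisj, hun, Measure.restrict_univ]
  rw [key, key fun ω => _ / _]
  refine tsum_congr fun π => ?_
  set p := ofPrefix t π with hp
  rw [hfol]
  have hmf : MeasurableSet (follows γ p t) := by rw [← hfol]; exact hmeas π
  -- the right-hand side is constant on the piece
  have hR : ∫⁻ ω in follows γ p t,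
      (∑ e ∈ allowedDirs (fun s => γ s ω) t, G (extend (fun s => γ s ω) t e)) /
        ((allowedDirs (fun s => γ s ω) t).card : ENNReal) ∂P =
      ∫⁻ _ in follows γ p t, (∑ e ∈ allowedDirs p t, G (extend p t e)) /
        ((allowedDirs p t).card : ENNReal) ∂P := by
    refine setLIntegral_congr_fun hmf fun ω hω => ?_
    have h1 : ∀ s ≤ t, (fun s => γ s ω) s = p s := hω
    simp only [allowedDirs_congr h1, extend_congr _ h1]
  rw [hR, setLIntegral_const]
  let B : ℤ × ℤ → Set Ω := fun e => follows γ p t ∩ {ω | γ (t + 1) ω = p t + e}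
  have hBm : ∀ e, MeasurableSet (B e) := fun e =>
    hmf.inter (hγ.measurable (t + 1) (measurableSet_singleton (p t + e)))
  have hBd : Pairwise (Function.onFun Disjoint B) := by
    intro a b hab
    refine Set.disjoint_left.2 fun ω ha hb => hab ?_
    have h1 : γ (t + 1) ω = p t + a := ha.2
    have h2 : γ (t + 1) ω = p t + b := hb.2
    rw [h1] at h2
    exact add_left_cancel h2
  have hBu : (⋃ e, B e) = follows γ p t := by
    ext ω
    simp only [Set.mem_iUnion, B, Set.mem_inter_iff, Set.mem_ofPred_eq, exists_and_left,
      and_iff_left_iff_imp]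
    intro _
    exact ⟨γ (t + 1) ω - p t, by abel⟩
  rw [← hBu, lintegral_iUnion hBm hBd]
  have hpiece : ∀ e, ∫⁻ ω in B e, G (fun s => γ s ω) ∂P = G (extend p t e) *
      if e ∈ allowedDirs p t then P (follows γ p t) / ((allowedDirs p t).card : ENNReal) else 0 := by
    intro e
    rw [← hγ.step t p e, ← setLIntegral_const]
    refine setLIntegral_congr_fun (hBm e) fun ω hω => ?_
    refine hG _ _ fun s hs => ?_
    rcases Nat.lt_or_ge t s with h | h
    · obtain rfl : s = t + 1 := by omega
      rw [extend_succ]; exact hω.2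
    · rw [extend_of_le _ _ h]; exact hω.1 s h
  rw [tsum_congr hpiece, tsum_eq_sum (s := allowedDirs p t), hBu]
  · simp only [div_eq_mul_inv, Finset.sum_mul]
    refine Finset.sum_congr rfl fun e he => ?_
    rw [if_pos he, mul_assoc, mul_comm (P _)]
  · intro e he
    simp [he]

theorem IsPrudentWalk.ae_prudent (hγ : IsPrudentWalk P γ) :
    ∀ᵐ ω ∂P, ∀ t, PrudentUpTo (fun s => γ s ω) t := by
  classical
  have h : ∀ t, ∀ᵐ ω ∂P, γ (t + 1) ω - γ t ω ∈ allowedDirs (fun s => γ s ω) t := by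
    intro t
    let G : Path → ENNReal := fun p => if p (t + 1) - p t ∈ allowedDirs p t then 0 else 1
    have hG : DeterminedBy G (t + 1) := by
      intro p q h
      have h' : ∀ s ≤ t, p s = q s := fun s hs => h s (hs.trans (Nat.le_succ t))
      simp only [G, h (t + 1) le_rfl, h' t le_rfl, allowedDirs_congr h']
    have h0 : ∫⁻ ω, G (fun s => γ s ω) ∂P = 0 := by
      rw [hγ.lintegral_step hG]
      have : ∀ ω, (∑ e ∈ allowedDirs (fun s => γ s ω) t, G (extend (fun s => γ s ω) t e)) /
        ((allowedDirs (fun s => γ s ω) t).card : ENNReal) = 0 := by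
        intro ω
        rw [Finset.sum_eq_zero, ENNReal.zero_div]
        intro e he
        have h1 : ∀ s ≤ t, extend (fun s => γ s ω) t e s = γ s ω := fun s hs => extend_of_le _ _ hs
        simp only [G, allowedDirs_congr h1, extend_succ, h1 t le_rfl, add_sub_cancel_left, if_pos he]
      simp [this]
    rw [lintegral_eq_zero_iff (hγ.measurable_comp hG)] at h0
    filter_upwards [h0] with ω hω
    by_contra hne
    simp [G, hne] at hω
  filter_upwards [ae_all_iff.2 h, hγ.start] with ω h1 h2 t
  exact ⟨h2, fun s _ => h1 s⟩

theorem PrudentUpTo.extend {p : Path} {t : ℕ} (h : PrudentUpTo p t) {e : ℤ × ℤ}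
    (he : e ∈ allowedDirs p t) : PrudentUpTo (extend p t e) (t + 1) := by
  refine ⟨by rw [extend_of_le _ _ (Nat.zero_le t)]; exact h.1, fun s hs => ?_⟩
  have hst : s ≤ t := Nat.le_of_lt_succ hs
  have h1 : ∀ r ≤ s, PrudentWalk.extend p t e r = p r := fun r hr => extend_of_le _ _ (hr.trans hst)
  rw [allowedDirs_congr h1, h1 s le_rfl]
  rcases hst.lt_or_eq with hlt | rfl
  · rw [extend_of_le _ _ (Nat.succ_le_of_lt hlt)]
    exact h.2 s hlt
  · rw [extend_succ, add_sub_cancel_left]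
    exact he

/-- Nonnegativity lets `ENNReal.ofReal` commute with the sum over the next steps. Times start at 1
because the walk has a side only after its first step. -/
theorem IsPrudentWalk.lintegral_supermartingale (hγ : IsPrudentWalk P γ) {G : ℕ → Path → ℝ}
    (hG : ∀ t, DeterminedBy (G t) t) (h0 : ∀ t, 1 ≤ t → ∀ p, PrudentUpTo p t → 0 ≤ G t p)
    (hstep : ∀ t, 1 ≤ t → ∀ p, PrudentUpTo p t →
      ∑ e ∈ allowedDirs p t, G (t + 1) (extend p t e) ≤ (allowedDirs p t).card * G t p)
    (t : ℕ) (ht : 1 ≤ t) :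
    ∫⁻ ω, ENNReal.ofReal (G t fun s => γ s ω) ∂P ≤
      ∫⁻ ω, ENNReal.ofReal (G 1 fun s => γ s ω) ∂P := by
  induction t, ht using Nat.le_induction with
  | base => exact le_rfl
  | succ t ht ih =>
    refine le_trans ?_ ih
    rw [hγ.lintegral_step (G := fun p => ENNReal.ofReal (G (t + 1) p))
      (fun p q h => by simp only [hG (t + 1) p q h])]
    refine lintegral_mono_ae ?_
    filter_upwards [hγ.ae_prudent] with ω hω
    rw [← ENNReal.ofReal_sum_of_nonneg fun e he =>
      h0 (t + 1) (by omega) _ ((hω t).extend he)]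
    refine ENNReal.div_le_of_le_mul' ?_
    rw [← ENNReal.ofReal_natCast, ← ENNReal.ofReal_mul (by positivity)]
    exact ENNReal.ofReal_le_ofReal (hstep t ht _ (hω t))

end Walk

/-! ### The walk along a side of its rectangle. -/

/-- Whether the walk has just moved to a new line outside the former rectangle, or is running
along the side away from, or towards, the corner where the excursion started. -/
inductive Heading
  | fresh
  | fwd
  | bwd

/-- The walk seen from the side of the rectangle it runs along. -/
structure SideState where
  /-- number of excursions (of both kinds) already completed -/
  j : ℕ
  /-- length of the current side -/
  L : ℕ
  /-- length of the other sides -/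
  M : ℕ
  /-- distance to the corner from which the excursion started -/
  y : ℕ
  /-- heading -/
  d : Heading

theorem allowedDirs_subset (p : Path) (t : ℕ) : allowedDirs p t ⊆ directions := by
  intro e he
  simp only [allowedDirs, Finset.mem_filter] at he
  exact he.1

namespace SideState

/-- A step outwards. -/
def out (s : SideState) : SideState := { s with M := s.M + 1, d := .fresh }

/-- A step beyond a corner. -/
def exit (s : SideState) : SideState := ⟨s.j + 1, s.M, s.L + 1, 0, .fresh⟩

/-- A step away from the starting corner. -/
def forward (s : SideState) : SideState :=
  if s.y + 1 < s.L then { s with y := s.y + 1, d := .fwd } else s.exit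

/-- A step towards the starting corner. -/
def backward (s : SideState) : SideState :=
  if s.y = 0 then s.exit else { s with y := s.y - 1, d := .bwd }

/-- `s` describes a path at time `t`, when `X` is its coordinate in the outward direction
and `Y` its coordinate along the side. -/
structure Describes (s : SideState) (X Y : ℕ → ℤ) (t : ℕ) : Prop where
  y_lt : s.y < s.L
  two_le : 2 ≤ s.M
  le_X : ∀ r ≤ t, X t - s.M + 1 ≤ X r
  X_le : ∀ r ≤ t, X r ≤ X t
  le_Y : ∀ r ≤ t, Y t - s.y ≤ Y r
  Y_le : ∀ r ≤ t, Y r ≤ Y t - s.y + s.L - 1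
  surj_X : ∀ z, X t - s.M + 1 ≤ z → z ≤ X t → ∃ r ≤ t, X r = z
  -- The clause `X r < X t` says that every line across the side carries a visited site strictly
  -- behind the walk; this is what forbids the inward direction.
  surj_Y : ∀ z, Y t - s.y ≤ z → z ≤ Y t - s.y + s.L - 1 → ∃ r ≤ t, Y r = z ∧ X r < X t
  of_fwd : s.d ≠ .bwd → ∀ r ≤ t, X r = X t → Y r ≤ Y t
  of_bwd : s.d ≠ .fwd → ∀ r ≤ t, X r = X t → Y t ≤ Y r
  blocked_fwd : s.d = .fwd → ∃ r ≤ t, X r = X t ∧ Y r = Y t - 1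
  blocked_bwd : s.d = .bwd → ∃ r ≤ t, X r = X t ∧ Y r = Y t + 1

variable {s : SideState} {X Y : ℕ → ℤ} {t : ℕ}

theorem forall_le_succ_iff {Q : ℕ → Prop} : (∀ r ≤ t + 1, Q r) ↔ (∀ r ≤ t, Q r) ∧ Q (t + 1) := by
  constructor
  · exact fun h => ⟨fun r hr => h r (by omega), h _ le_rfl⟩
  · rintro ⟨h1, h2⟩ r hr
    rcases Nat.lt_or_ge t r with h | h
    · obtain rfl : r = t + 1 := by omega
      exact h2
    · exact h1 r h

theorem Describes.out (h : s.Describes X Y t) (hX : X (t + 1) = X t + 1) (hY : Y (t + 1) = Y t) :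
    s.out.Describes X Y (t + 1) := by
  obtain ⟨h1, h2, h3, h4, h5, h6, h7, h8, h9, h10, h11, h12⟩ := h
  have hcol : ∀ r ≤ t, X r ≠ X t + 1 := fun r hr => by have := h4 r hr; omega
  constructor <;> simp only [SideState.out, forall_le_succ_iff, hX, hY]
  · exact h1
  · omega
  · refine ⟨fun r hr => ?_, ?_⟩
    · have := h3 r hr; push_cast; omega
    · push_cast; omega
  · refine ⟨fun r hr => ?_, le_rfl⟩
    have := h4 r hr; omega
  · exact ⟨h5, by omega⟩
  · exact ⟨h6, by omega⟩
  · intro z hz1 hz2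
    push_cast at hz1
    rcases eq_or_lt_of_le hz2 with h | h
    · exact ⟨t + 1, le_rfl, by omega⟩
    · obtain ⟨r, hr, hr'⟩ := h7 z (by omega) (by omega)
      exact ⟨r, by omega, hr'⟩
  · intro z hz1 hz2
    obtain ⟨r, hr, hr1, hr2⟩ := h8 z hz1 hz2
    exact ⟨r, by omega, hr1, by omega⟩
  · exact fun _ => ⟨fun r hr h => absurd h (hcol r hr), fun _ => le_rfl⟩
  · exact fun _ => ⟨fun r hr h => absurd h (hcol r hr), fun _ => le_rfl⟩
  · simp
  · simp

theorem Describes.forward (h : s.Describes X Y t) (hX : X (t + 1) = X t)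
    (hY : Y (t + 1) = Y t + 1) (hd : s.d ≠ .bwd) (hy : s.y + 1 < s.L) :
    s.forward.Describes X Y (t + 1) := by
  obtain ⟨h1, h2, h3, h4, h5, h6, h7, h8, h9, h10, h11, h12⟩ := h
  rw [SideState.forward, if_pos hy]
  constructor <;> simp only [forall_le_succ_iff, hX, hY]
  · exact hy
  · omega
  · exact ⟨h3, by omega⟩
  · exact ⟨h4, by omega⟩
  · refine ⟨fun r hr => ?_, by omega⟩
    have := h5 r hr; push_cast; omega
  · refine ⟨fun r hr => ?_, by omega⟩
    have := h6 r hr; push_cast; omega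
  · intro z hz1 hz2
    obtain ⟨r, hr, hr'⟩ := h7 z hz1 hz2
    exact ⟨r, by omega, hr'⟩
  · intro z hz1 hz2
    push_cast at hz1 hz2
    obtain ⟨r, hr, hr1, hr2⟩ := h8 z (by omega) (by omega)
    exact ⟨r, by omega, hr1, by omega⟩
  · refine fun _ => ⟨fun r hr h => ?_, fun _ => le_rfl⟩
    have := h9 hd r hr h; omega
  · simp
  · exact fun _ => ⟨t, by omega, rfl, by omega⟩
  · simp

theorem Describes.backward (h : s.Describes X Y t) (hX : X (t + 1) = X t)
    (hY : Y (t + 1) = Y t - 1) (hd : s.d ≠ .fwd) (hy : s.y ≠ 0) :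
    s.backward.Describes X Y (t + 1) := by
  obtain ⟨h1, h2, h3, h4, h5, h6, h7, h8, h9, h10, h11, h12⟩ := h
  rw [SideState.backward, if_neg hy]
  obtain ⟨y, hy'⟩ := Nat.exists_eq_succ_of_ne_zero hy
  constructor <;> simp only [forall_le_succ_iff, hX, hY]
  · omega
  · omega
  · exact ⟨h3, by omega⟩
  · exact ⟨h4, by omega⟩
  · refine ⟨fun r hr => ?_, by omega⟩
    have := h5 r hr; omega
  · refine ⟨fun r hr => ?_, by omega⟩
    have := h6 r hr; omega
  · intro z hz1 hz2
    obtain ⟨r, hr, hr'⟩ := h7 z hz1 hz2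
    exact ⟨r, by omega, hr'⟩
  · intro z hz1 hz2
    obtain ⟨r, hr, hr1, hr2⟩ := h8 z (by omega) (by omega)
    exact ⟨r, by omega, hr1, by omega⟩
  · simp
  · refine fun _ => ⟨fun r hr h => ?_, fun _ => le_rfl⟩
    have := h10 hd r hr h; omega
  · simp
  · exact fun _ => ⟨t, by omega, rfl, by omega⟩

/-- The walk turns around a corner where `X` is maximal, so on its new side the direction away from
this corner is that of `-X`. The same holds for the near exit, where the outward coordinate is `-Y`.
-/
theorem Describes.exit_far (h : s.Describes X Y t) (hX : X (t + 1) = X t)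
    (hY : Y (t + 1) = Y t + 1) (hy : ¬ s.y + 1 < s.L) :
    s.exit.Describes Y (fun r => -X r) (t + 1) := by
  obtain ⟨h1, h2, h3, h4, h5, h6, h7, h8, h9, h10, h11, h12⟩ := h
  have hcol : ∀ r ≤ t, Y r ≠ Y t + 1 := fun r hr => by have := h6 r hr; omega
  constructor <;> simp only [SideState.exit, forall_le_succ_iff, hX, hY]
  · omega
  · omega
  · refine ⟨fun r hr => ?_, by omega⟩
    have := h5 r hr; push_cast; omega
  · refine ⟨fun r hr => ?_, by omega⟩
    have := h6 r hr; omega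
  · refine ⟨fun r hr => ?_, by omega⟩
    have := h4 r hr; push_cast; omega
  · refine ⟨fun r hr => ?_, by omega⟩
    have := h3 r hr; push_cast; omega
  · intro z hz1 hz2
    push_cast at hz1
    rcases eq_or_lt_of_le hz2 with h | h
    · exact ⟨t + 1, le_rfl, by omega⟩
    · obtain ⟨r, hr, hr', -⟩ := h8 z (by omega) (by omega)
      exact ⟨r, by omega, hr'⟩
  · intro z hz1 hz2
    push_cast at hz1 hz2
    obtain ⟨r, hr, hr1⟩ := h7 (-z) (by omega) (by omega)
    have := h6 r hr
    exact ⟨r, by omega, by omega, by omega⟩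
  · exact fun _ => ⟨fun r hr h => absurd h (hcol r hr), fun _ => le_rfl⟩
  · exact fun _ => ⟨fun r hr h => absurd h (hcol r hr), fun _ => le_rfl⟩
  · simp
  · simp

theorem Describes.exit_near (h : s.Describes X Y t) (hX : X (t + 1) = X t)
    (hY : Y (t + 1) = Y t - 1) (hy : s.y = 0) :
    s.exit.Describes (fun r => -Y r) (fun r => -X r) (t + 1) := by
  obtain ⟨h1, h2, h3, h4, h5, h6, h7, h8, h9, h10, h11, h12⟩ := h
  have hcol : ∀ r ≤ t, -Y r ≠ -(Y t - 1) := fun r hr => by have := h5 r hr; omega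
  constructor <;> simp only [SideState.exit, forall_le_succ_iff, hX, hY]
  · omega
  · omega
  · refine ⟨fun r hr => ?_, by omega⟩
    have := h6 r hr; push_cast; omega
  · refine ⟨fun r hr => ?_, by omega⟩
    have := h5 r hr; omega
  · refine ⟨fun r hr => ?_, by omega⟩
    have := h4 r hr; push_cast; omega
  · refine ⟨fun r hr => ?_, by omega⟩
    have := h3 r hr; push_cast; omega
  · intro z hz1 hz2
    push_cast at hz1
    rcases eq_or_lt_of_le hz2 with h | h
    · exact ⟨t + 1, le_rfl, by omega⟩
    · obtain ⟨r, hr, hr', -⟩ := h8 (-z) (by omega) (by omega)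
      exact ⟨r, by omega, by omega⟩
  · intro z hz1 hz2
    push_cast at hz1 hz2
    obtain ⟨r, hr, hr1⟩ := h7 (-z) (by omega) (by omega)
    have := h5 r hr
    exact ⟨r, by omega, by omega, by omega⟩
  · exact fun _ => ⟨fun r hr h => absurd h (hcol r hr), fun _ => le_rfl⟩
  · exact fun _ => ⟨fun r hr h => absurd h (hcol r hr), fun _ => le_rfl⟩
  · simp
  · simp

end SideState

/-! ### Orthogonal frames of lattice directions. -/

/-- The coordinate of `a` in the direction `b`. -/
def dot (a b : ℤ × ℤ) : ℤ := a.1 * b.1 + a.2 * b.2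

theorem dot_add (a b c : ℤ × ℤ) : dot (a + b) c = dot a c + dot b c := by
  simp only [dot, Prod.fst_add, Prod.snd_add]; ring

theorem dot_nsmul (k : ℕ) (a c : ℤ × ℤ) : dot (k • a) c = k * dot a c := by
  simp only [dot, Prod.smul_def, nsmul_eq_mul]; ring

theorem dot_neg (a c : ℤ × ℤ) : dot a (-c) = -dot a c := by
  simp only [dot, Prod.fst_neg, Prod.snd_neg]; ring

theorem neg_dot (a c : ℤ × ℤ) : dot (-a) c = -dot a c := by
  simp only [dot, Prod.fst_neg, Prod.snd_neg]; ring

/-- `u` and `v` are orthogonal lattice directions. -/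
structure IsFrame (u v : ℤ × ℤ) : Prop where
  u_mem : u ∈ directions
  v_mem : v ∈ directions
  orth : dot u v = 0

namespace IsFrame

variable {u v : ℤ × ℤ}

theorem cases (h : IsFrame u v) :
    (u = (1, 0) ∨ u = (-1, 0)) ∧ (v = (0, 1) ∨ v = (0, -1)) ∨
      (u = (0, 1) ∨ u = (0, -1)) ∧ (v = (1, 0) ∨ v = (-1, 0)) := by
  obtain ⟨h1, h2, h3⟩ := h
  simp only [directions, Finset.mem_insert, Finset.mem_singleton] at h1 h2
  rcases h1 with rfl | rfl | rfl | rfl <;> rcases h2 with rfl | rfl | rfl | rfl <;>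
    simp [dot] at h3 ⊢

theorem dot_self_left (h : IsFrame u v) : dot u u = 1 := by
  rcases h.cases with ⟨rfl | rfl, rfl | rfl⟩ | ⟨rfl | rfl, rfl | rfl⟩ <;> simp [dot]

theorem dot_self_right (h : IsFrame u v) : dot v v = 1 := by
  rcases h.cases with ⟨rfl | rfl, rfl | rfl⟩ | ⟨rfl | rfl, rfl | rfl⟩ <;> simp [dot]

theorem orth' (h : IsFrame u v) : dot v u = 0 := by
  rcases h.cases with ⟨rfl | rfl, rfl | rfl⟩ | ⟨rfl | rfl, rfl | rfl⟩ <;> simp [dot]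

theorem ext_iff (h : IsFrame u v) {a b : ℤ × ℤ} : a = b ↔ dot a u = dot b u ∧ dot a v = dot b v := by
  rcases h.cases with ⟨rfl | rfl, rfl | rfl⟩ | ⟨rfl | rfl, rfl | rfl⟩ <;>
    simp [dot, Prod.ext_iff, and_comm]

theorem mem_directions (h : IsFrame u v) {e : ℤ × ℤ} :
    e ∈ directions ↔ e = u ∨ e = -u ∨ e = v ∨ e = -v := by
  rcases h.cases with ⟨rfl | rfl, rfl | rfl⟩ | ⟨rfl | rfl, rfl | rfl⟩ <;>
    simp only [directions, Finset.mem_insert, Finset.mem_singleton, Prod.neg_mk, neg_neg,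
      neg_zero] <;> tauto

theorem left_ne_right (h : IsFrame u v) : u ≠ v := by
  rcases h.cases with ⟨rfl | rfl, rfl | rfl⟩ | ⟨rfl | rfl, rfl | rfl⟩ <;> simp

theorem left_ne_neg_right (h : IsFrame u v) : u ≠ -v := by
  rcases h.cases with ⟨rfl | rfl, rfl | rfl⟩ | ⟨rfl | rfl, rfl | rfl⟩ <;> simp

theorem right_ne_neg_right (h : IsFrame u v) : v ≠ -v := by
  rcases h.cases with ⟨rfl | rfl, rfl | rfl⟩ | ⟨rfl | rfl, rfl | rfl⟩ <;> simp

theorem far (h : IsFrame u v) : IsFrame v (-u) := by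
  rcases h.cases with ⟨rfl | rfl, rfl | rfl⟩ | ⟨rfl | rfl, rfl | rfl⟩ <;>
    constructor <;> simp [directions, dot]

theorem near (h : IsFrame u v) : IsFrame (-v) (-u) := by
  rcases h.cases with ⟨rfl | rfl, rfl | rfl⟩ | ⟨rfl | rfl, rfl | rfl⟩ <;>
    constructor <;> simp [directions, dot]

theorem swap (h : IsFrame u v) : IsFrame u.swap v.swap := by
  rcases h.cases with ⟨rfl | rfl, rfl | rfl⟩ | ⟨rfl | rfl, rfl | rfl⟩ <;>
    constructor <;> simp [directions, dot]

end IsFrame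

/-! ### Allowed directions and transitions, read in the moving frame. -/

/-- A side state, with the outward direction and the direction of the side (away from the
starting corner). -/
structure State where
  /-- the state as seen from the side -/
  s : SideState
  /-- outward direction -/
  u : ℤ × ℤ
  /-- direction along the side -/
  v : ℤ × ℤ

namespace State

/-- The effect of the step `e`. -/
def step (σ : State) (e : ℤ × ℤ) : State :=
  if e = σ.u then ⟨σ.s.out, σ.u, σ.v⟩
  else if e = σ.v then
    if σ.s.y + 1 < σ.s.L then ⟨σ.s.forward, σ.u, σ.v⟩ else ⟨σ.s.exit, σ.v, -σ.u⟩
  else if σ.s.y = 0 then ⟨σ.s.exit, -σ.v, -σ.u⟩ else ⟨σ.s.backward, σ.u, σ.v⟩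

/-- `σ` describes the path `p` at time `t`. -/
structure Describes (σ : State) (p : Path) (t : ℕ) : Prop where
  frame : IsFrame σ.u σ.v
  side : σ.s.Describes (fun r => dot (p r) σ.u) (fun r => dot (p r) σ.v) t

variable {σ : State} {p : Path} {t : ℕ}

theorem step_s_u (σ : State) : (σ.step σ.u).s = σ.s.out := by simp [step]

theorem step_s_v (h : IsFrame σ.u σ.v) : (σ.step σ.v).s = σ.s.forward := by
  simp only [step, if_neg h.left_ne_right.symm, if_pos, SideState.forward]
  split_ifs <;> rfl

theorem step_s_neg_v (h : IsFrame σ.u σ.v) : (σ.step (-σ.v)).s = σ.s.backward := by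
  simp only [step, if_neg h.left_ne_neg_right.symm, if_neg h.right_ne_neg_right.symm,
    SideState.backward]
  split_ifs <;> rfl

namespace Describes

theorem u_mem_allowedDirs (h : σ.Describes p t) : σ.u ∈ allowedDirs p t := by
  simp only [allowedDirs, Finset.mem_filter]
  refine ⟨h.frame.u_mem, fun k hk r hr heq => ?_⟩
  have h1 := congrArg (dot · σ.u) heq
  simp only [dot_add, dot_nsmul, h.frame.dot_self_left] at h1
  have := h.side.X_le r hr
  omega

theorem neg_u_not_mem_allowedDirs (h : σ.Describes p t) : -σ.u ∉ allowedDirs p t := by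
  simp only [allowedDirs, Finset.mem_filter, not_and, not_forall, not_not]
  intro _
  have hy := h.side.y_lt
  obtain ⟨r, hr, h1, h2⟩ := h.side.surj_Y (dot (p t) σ.v) (by omega) (by omega)
  refine ⟨(dot (p t) σ.u - dot (p r) σ.u).toNat, by omega, r, hr, ?_⟩
  rw [h.frame.ext_iff]
  simp only [dot_add, dot_nsmul, neg_dot, h.frame.dot_self_left, h.frame.orth, h1]
  constructor
  · rw [Int.toNat_of_nonneg (by omega)]; ring
  · ring

theorem v_mem_allowedDirs_iff (h : σ.Describes p t) : σ.v ∈ allowedDirs p t ↔ σ.s.d ≠ .bwd := by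
  simp only [allowedDirs, Finset.mem_filter]
  constructor
  · rintro ⟨-, h1⟩ hd
    obtain ⟨r, hr, hX, hY⟩ := h.side.blocked_bwd hd
    refine h1 1 one_pos r hr ?_
    rw [h.frame.ext_iff]
    simp only [dot_add, one_smul, h.frame.dot_self_right, h.frame.orth', hX, hY]
    simp
  · refine fun hd => ⟨h.frame.v_mem, fun k hk r hr heq => ?_⟩
    have h1 := congrArg (dot · σ.u) heq
    have h2 := congrArg (dot · σ.v) heq
    simp only [dot_add, dot_nsmul, h.frame.dot_self_right, h.frame.orth'] at h1 h2
    have := h.side.of_fwd hd r hr (by omega)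
    omega

theorem neg_v_mem_allowedDirs_iff (h : σ.Describes p t) :
    -σ.v ∈ allowedDirs p t ↔ σ.s.d ≠ .fwd := by
  simp only [allowedDirs, Finset.mem_filter]
  constructor
  · rintro ⟨-, h1⟩ hd
    obtain ⟨r, hr, hX, hY⟩ := h.side.blocked_fwd hd
    refine h1 1 one_pos r hr ?_
    rw [h.frame.ext_iff]
    simp only [dot_add, neg_dot, one_smul, h.frame.dot_self_right, h.frame.orth', hX, hY]
    constructor <;> ring
  · refine fun hd => ⟨?_, fun k hk r hr heq => ?_⟩
    · rw [h.frame.mem_directions]; tauto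
    have h1 := congrArg (dot · σ.u) heq
    have h2 := congrArg (dot · σ.v) heq
    simp only [dot_add, neg_dot, dot_nsmul, h.frame.dot_self_right, h.frame.orth'] at h1 h2
    have := h.side.of_bwd hd r hr (by omega)
    omega

theorem mem_allowedDirs_iff (h : σ.Describes p t) {e : ℤ × ℤ} : e ∈ allowedDirs p t ↔
    e = σ.u ∨ e = σ.v ∧ σ.s.d ≠ .bwd ∨ e = -σ.v ∧ σ.s.d ≠ .fwd := by
  constructor
  · intro he
    rcases h.frame.mem_directions.1 (allowedDirs_subset p t he) with rfl | rfl | rfl | rfl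
    · exact .inl rfl
    · exact absurd he h.neg_u_not_mem_allowedDirs
    · exact .inr (.inl ⟨rfl, h.v_mem_allowedDirs_iff.1 he⟩)
    · exact .inr (.inr ⟨rfl, h.neg_v_mem_allowedDirs_iff.1 he⟩)
  · rintro (rfl | ⟨rfl, hd⟩ | ⟨rfl, hd⟩)
    · exact h.u_mem_allowedDirs
    · exact h.v_mem_allowedDirs_iff.2 hd
    · exact h.neg_v_mem_allowedDirs_iff.2 hd

theorem step (h : σ.Describes p t) (he : p (t + 1) - p t ∈ allowedDirs p t) :
    (σ.step (p (t + 1) - p t)).Describes p (t + 1) := by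
  have hp : p (t + 1) = p t + (p (t + 1) - p t) := by abel
  generalize p (t + 1) - p t = e at he hp
  have hf := h.frame
  have hu := congrArg (dot · σ.u) hp
  have hv := congrArg (dot · σ.v) hp
  simp only [dot_add] at hu hv
  rcases h.mem_allowedDirs_iff.1 he with rfl | ⟨rfl, hd⟩ | ⟨rfl, hd⟩
  · simp only [hf.dot_self_left, hf.orth, add_zero] at hu hv
    simp only [State.step, if_true]
    exact ⟨hf, h.side.out hu hv⟩
  · simp only [hf.dot_self_right, hf.orth', add_zero] at hu hv
    simp only [State.step, if_neg hf.left_ne_right.symm, if_true]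
    split_ifs with hy
    · exact ⟨hf, h.side.forward hu hv hd hy⟩
    · refine ⟨hf.far, ?_⟩
      simpa only [dot_neg] using h.side.exit_far hu hv hy
  · simp only [neg_dot, hf.dot_self_right, hf.orth', add_zero, neg_zero] at hu hv
    simp only [State.step, if_neg hf.left_ne_neg_right.symm, if_neg hf.right_ne_neg_right.symm]
    split_ifs with hy
    · refine ⟨hf.near, ?_⟩
      simpa only [dot_neg] using h.side.exit_near hu hv hy
    · exact ⟨hf, h.side.backward hu hv hd hy⟩

end Describes

end State

/-! ### The sequence of states along a path. -/

/-- The state after the first step. -/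
def initState (e : ℤ × ℤ) : State := ⟨⟨0, 1, 2, 0, .fresh⟩, e, (-e.2, e.1)⟩

/-- The state of the path `p` at time `t`, relevant for `t ≥ 1`. -/
def stateAt (p : Path) : ℕ → State
  | 0 => initState 0
  | 1 => initState (p 1 - p 0)
  | t + 2 => (stateAt p (t + 1)).step (p (t + 2) - p (t + 1))

theorem stateAt_succ (p : Path) {t : ℕ} (ht : 1 ≤ t) :
    stateAt p (t + 1) = (stateAt p t).step (p (t + 1) - p t) := by
  obtain ⟨t, rfl⟩ := Nat.exists_eq_add_of_le' ht
  rfl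

theorem stateAt_congr {p q : Path} : ∀ {t : ℕ}, (∀ s ≤ t, p s = q s) → stateAt p t = stateAt q t
  | 0, _ => rfl
  | 1, h => by simp only [stateAt, h 0 (by omega), h 1 le_rfl]
  | t + 2, h => by
    simp only [stateAt, h (t + 2) le_rfl, h (t + 1) (by omega),
      stateAt_congr (t := t + 1) fun s hs => h s (by omega)]

theorem isFrame_rotate {e : ℤ × ℤ} (h : e ∈ directions) : IsFrame e (-e.2, e.1) := by
  simp only [directions, Finset.mem_insert, Finset.mem_singleton] at h
  rcases h with rfl | rfl | rfl | rfl <;> constructor <;> simp [directions, dot]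

theorem initState_describes {p : Path} (h : p 1 - p 0 ∈ directions) :
    (initState (p 1 - p 0)).Describes p 1 := by
  have hf := isFrame_rotate h
  have hp : p 1 = p 0 + (p 1 - p 0) := by abel
  generalize p 1 - p 0 = e at hf hp
  set v : ℤ × ℤ := (-e.2, e.1) with hvdef
  have hu := congrArg (dot · e) hp
  have hv := congrArg (dot · v) hp
  simp only [dot_add, hf.dot_self_left, hf.orth, add_zero] at hu hv
  refine ⟨hf, ?_⟩
  have hr : ∀ r : ℕ, r ≤ 1 → r = 0 ∨ r = 1 := fun r hr => by omega
  constructor <;> simp only [initState, ← hvdef]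
  · simp
  · simp
  · intro r h; rcases hr r h with rfl | rfl <;> push_cast <;> omega
  · intro r h; rcases hr r h with rfl | rfl <;> omega
  · intro r h; rcases hr r h with rfl | rfl <;> push_cast <;> omega
  · intro r h; rcases hr r h with rfl | rfl <;> push_cast <;> omega
  · intro z h1 h2
    push_cast at h1
    rcases eq_or_lt_of_le h2 with h | h
    · exact ⟨1, le_rfl, h.symm⟩
    · exact ⟨0, by omega, by omega⟩
  · intro z h1 h2
    push_cast at h1 h2
    exact ⟨0, by omega, by omega, by omega⟩
  · intro _ r h; rcases hr r h with rfl | rfl <;> omega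
  · intro _ r h; rcases hr r h with rfl | rfl <;> omega
  · simp
  · simp

theorem PrudentUpTo.mono {p : Path} {s t : ℕ} (h : PrudentUpTo p t) (hst : s ≤ t) :
    PrudentUpTo p s := ⟨h.1, fun r hr => h.2 r (hr.trans_le hst)⟩

theorem PrudentUpTo.describes {p : Path} {t : ℕ} (h : PrudentUpTo p t) (ht : 1 ≤ t) :
    (stateAt p t).Describes p t := by
  induction t, ht using Nat.le_induction with
  | base => exact initState_describes (allowedDirs_subset p 0 (h.2 0 one_pos))
  | succ t ht ih =>
    rw [stateAt_succ p ht]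
    exact (ih (h.mono t.le_succ)).step (h.2 t t.lt_succ_self)

/-- The sum of `f` over the states that may follow `s`. -/
def SideState.sumNext (f : SideState → ℝ) (s : SideState) : ℝ :=
  match s.d with
  | .fresh => f s.out + f s.forward + f s.backward
  | .fwd => f s.out + f s.forward
  | .bwd => f s.out + f s.backward

/-- The number of states that may follow `s`. -/
def SideState.numNext (s : SideState) : ℝ :=
  match s.d with
  | .fresh => 3
  | .fwd => 2
  | .bwd => 2

/-- The transitions do not depend on the frame, so the supermartingale inequalities reduce to real
inequalities on `SideState`. -/
theorem State.Describes.sum_allowedDirs {σ : State} {p : Path} {t : ℕ} (h : σ.Describes p t)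
    (f : SideState → ℝ) :
    ∑ e ∈ allowedDirs p t, f (σ.step e).s = SideState.sumNext f σ.s ∧
      ((allowedDirs p t).card : ℝ) = SideState.numNext σ.s := by
  classical
  have hf := h.frame
  rcases hd : σ.s.d with _ | _ | _
  · have : allowedDirs p t = {σ.u, σ.v, -σ.v} := by
      ext e; rw [h.mem_allowedDirs_iff]; simp [hd]
    rw [this, Finset.sum_insert (by simp [hf.left_ne_right, hf.left_ne_neg_right]),
      Finset.sum_pair hf.right_ne_neg_right,
      Finset.card_insert_of_notMem (by simp [hf.left_ne_right, hf.left_ne_neg_right]),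
      Finset.card_pair hf.right_ne_neg_right, State.step_s_u, State.step_s_v hf,
      State.step_s_neg_v hf]
    simp only [SideState.sumNext, SideState.numNext, hd]
    constructor
    · ring
    · norm_num
  · have : allowedDirs p t = {σ.u, σ.v} := by
      ext e; rw [h.mem_allowedDirs_iff]; simp [hd]
    rw [this, Finset.sum_pair hf.left_ne_right, Finset.card_pair hf.left_ne_right,
      State.step_s_u, State.step_s_v hf]
    simp [SideState.sumNext, SideState.numNext, hd]
  · have : allowedDirs p t = {σ.u, -σ.v} := by
      ext e; rw [h.mem_allowedDirs_iff]; simp [hd]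
    rw [this, Finset.sum_pair hf.left_ne_neg_right, Finset.card_pair hf.left_ne_neg_right,
      State.step_s_u, State.step_s_neg_v hf]
    simp [SideState.sumNext, SideState.numNext, hd]

/-! ### Potentials: linear for crossing, sine for lasting, parabola for duration. -/

namespace SideState

/-- Elementary constraints satisfied by all the states visited by the walk. -/
structure Valid (s : SideState) : Prop where
  y_lt : s.y < s.L
  -- An exit exchanges the two lengths and adds one site to the old side, so each length grows by at
  -- least one every two excursions. In particular `2 * m ≤ s.j` gives `m ≤ s.L`.
  le_L : s.j + 1 ≤ 2 * s.L
  le_M : s.j + 2 ≤ 2 * s.M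
  L_eq : s.j = 0 → s.L = 1

theorem Valid.out {s : SideState} (h : s.Valid) : s.out.Valid := by
  obtain ⟨h1, h2, h3, h4⟩ := h
  constructor <;> simp only [SideState.out]
  · exact h1
  · exact h2
  · omega
  · exact h4

theorem Valid.exit {s : SideState} (h : s.Valid) : s.exit.Valid := by
  obtain ⟨h1, h2, h3, h4⟩ := h
  constructor <;> simp only [SideState.exit] <;> omega

theorem Valid.forward {s : SideState} (h : s.Valid) : s.forward.Valid := by
  unfold SideState.forward
  split_ifs with hy
  · obtain ⟨h1, h2, h3, h4⟩ := h
    constructor <;> simp only <;> omega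
  · exact h.exit

theorem Valid.backward {s : SideState} (h : s.Valid) : s.backward.Valid := by
  unfold SideState.backward
  split_ifs with hy
  · exact h.exit
  · obtain ⟨h1, h2, h3, h4⟩ := h
    constructor <;> simp only <;> omega

theorem sumNext_mono {f g : SideState → ℝ} {s : SideState} (h1 : f s.out ≤ g s.out)
    (h2 : f s.forward ≤ g s.forward) (h3 : f s.backward ≤ g s.backward) :
    sumNext f s ≤ sumNext g s := by
  unfold sumNext
  split <;> linarith

theorem sumNext_mono_of_exit {f g : SideState → ℝ} {s : SideState}
    (h : ∀ s' : SideState, s'.j = s.j → s'.L = s.L → f s' ≤ g s') (hex : f s.exit ≤ g s.exit) :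
    sumNext f s ≤ sumNext g s := by
  refine sumNext_mono (h s.out rfl rfl) ?_ ?_
  · unfold forward
    split_ifs
    · exact h ⟨s.j, s.L, s.M, s.y + 1, .fwd⟩ rfl rfl
    · exact hex
  · unfold backward
    split_ifs
    · exact hex
    · exact h ⟨s.j, s.L, s.M, s.y - 1, .bwd⟩ rfl rfl

theorem sumNext_const (s : SideState) (c : ℝ) : sumNext (fun _ => c) s = s.numNext * c := by
  rcases s with ⟨j, L, M, y, _ | _ | _⟩ <;> simp only [sumNext, numNext] <;> ring

theorem sumNext_affine (s : SideState) (a b : ℝ) (f : SideState → ℝ) :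
    sumNext (fun s => a + b * (1 - f s)) s = s.numNext * (a + b) - b * sumNext f s := by
  rcases s with ⟨j, L, M, y, _ | _ | _⟩ <;> simp only [sumNext, numNext] <;> ring

/-- The probability, up to a constant, to reach the far end of the side. -/
noncomputable def crossPotential (s : SideState) : ℝ :=
  match s.d with
  | .fresh => (s.y + 2) / s.L
  | .fwd => (s.y + 3) / s.L
  | .bwd => (s.y + 1) / s.L

theorem crossPotential_nonneg (s : SideState) : 0 ≤ s.crossPotential := by
  unfold crossPotential
  split <;> positivity

theorem one_le_crossPotential {s : SideState} (h : s.y + 1 = s.L) : 1 ≤ s.crossPotential := by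
  have hL : (s.L : ℝ) = s.y + 1 := by rw [← h]; push_cast; ring
  have : (0 : ℝ) ≤ s.y := by positivity
  unfold crossPotential
  split <;> rw [hL, le_div_iff₀ (by linarith)] <;> linarith

/-- A straight run continues with probability 1/2 at each step, hence by one more site on average;
this explains the shift by one between headings, which makes the linear function harmonic. The
offset 2 makes it vanish on a near exit, where it would be read at `y = -1` with heading `bwd`. -/
theorem sumNext_crossPotential_le {f : SideState → ℝ} {s : SideState} (hy : s.y + 1 < s.L)
    (hf : ∀ s' : SideState, s'.j = s.j → f s' = s'.crossPotential)
    (hf' : f s.exit = 0) : sumNext f s ≤ s.numNext * s.crossPotential := by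
  have hL : (0 : ℝ) < s.L := by exact_mod_cast (by omega : 0 < s.L)
  have h1 : f s.out * s.L = s.y + 2 := by
    rw [hf s.out rfl]; simp only [crossPotential, out]; field_simp
  have h2 : f s.forward * s.L = s.y + 4 := by
    simp only [forward, if_pos hy]
    rw [hf ⟨s.j, s.L, s.M, s.y + 1, .fwd⟩ rfl]; simp only [crossPotential]; push_cast
    field_simp; ring
  have h3 : f s.backward * s.L ≤ s.y := by
    unfold backward
    split_ifs with h0
    · rw [hf', zero_mul]; positivity
    · rw [hf ⟨s.j, s.L, s.M, s.y - 1, .bwd⟩ rfl]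
      obtain ⟨k, hk⟩ := Nat.exists_eq_succ_of_ne_zero h0
      simp only [crossPotential, hk, Nat.succ_sub_one]
      rw [div_mul_cancel₀ _ hL.ne']
      push_cast; linarith
  refine le_of_mul_le_mul_right ?_ hL
  rcases hd : s.d with _ | _ | _ <;> simp only [sumNext, numNext, crossPotential, hd] <;>
    rw [mul_assoc, div_mul_cancel₀ _ hL.ne'] <;> linarith

/-- The sine profile that vanishes at `0` and at `m`. -/
noncomputable def profile (m : ℕ) (x : ℝ) : ℝ := Real.sin (Real.pi / m * x)

theorem profile_nonneg {m : ℕ} {x : ℝ} (hm : 0 < m) (hx : 0 ≤ x) (hx' : x ≤ m) :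
    0 ≤ profile m x := by
  have hm' : (0 : ℝ) < m := by exact_mod_cast hm
  refine Real.sin_nonneg_of_nonneg_of_le_pi (by positivity) ?_
  rw [div_mul_eq_mul_div, div_le_iff₀ hm']
  exact mul_le_mul_of_nonneg_left hx' Real.pi_pos.le

theorem profile_add (m : ℕ) (x : ℝ) :
    profile m (x + 2) + profile m x = 2 * Real.cos (Real.pi / m) * profile m (x + 1) := by
  have h1 : Real.pi / m * (x + 2) = Real.pi / m * (x + 1) + Real.pi / m := by ring
  have h2 : Real.pi / m * x = Real.pi / m * (x + 1) - Real.pi / m := by ring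
  rw [profile, profile, profile, h1, h2, Real.sin_add, Real.sin_sub]
  ring

/-- The extension of the sine profile to all the headings. -/
noncomputable def headingProfile (m y : ℕ) : Heading → ℝ
  | .fresh => profile m (y + 1)
  -- The values on runs are those for which the potential, multiplied by `lineRate m` to the power
  -- of the number of lines still to come, is harmonic: by `profile_add`, `2 * H y = (5 - 4 * cos (π
  -- / m)) * profile m (y + 1) + H (y + 1)` for this `H`.
  | .fwd => 2 * profile m (y + 1) - profile m y
  | .bwd => 2 * profile m (y + 1) - profile m (y + 2)

/-- The probability that the excursion survives a line, for the sine profile. -/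
noncomputable def lineRate (m : ℕ) : ℝ := (5 - 4 * Real.cos (Real.pi / m))⁻¹

theorem one_le_inv_lineRate (m : ℕ) : 1 ≤ 5 - 4 * Real.cos (Real.pi / m) := by
  linarith [Real.cos_le_one (Real.pi / m)]

theorem lineRate_pos (m : ℕ) : 0 < lineRate m :=
  inv_pos.2 (zero_lt_one.trans_le (one_le_inv_lineRate m))

theorem lineRate_le_one (m : ℕ) : lineRate m ≤ 1 := inv_le_one_of_one_le₀ (one_le_inv_lineRate m)

theorem headingProfile_le (m y : ℕ) (d : Heading) : headingProfile m y d ≤ 3 := by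
  have h1 := Real.sin_le_one (Real.pi / m * (y + 1))
  have h2 := Real.neg_one_le_sin (Real.pi / m * y)
  have h3 := Real.neg_one_le_sin (Real.pi / m * (y + 2))
  rcases d with _ | _ | _ <;> simp only [headingProfile, profile] <;> linarith

/-- A lower bound for the probability that the excursion lasts until the other side of the
rectangle has length `m ^ 2`. -/
noncomputable def lasting (m : ℕ) (s : SideState) : ℝ :=
  if m ^ 2 ≤ s.M then 1
  -- The walk is killed at `y + 1 = m`. The factor 1/3 keeps the value at most 1, as
  -- `headingProfile` is at most 3; the maximum with 0 is needed because `headingProfile` may be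
  -- negative on runs near the ends.
  else if s.y + 1 < m then 1 / 3 * lineRate m ^ (m ^ 2 - s.M) * max 0 (headingProfile m s.y s.d)
  else 0

theorem lasting_nonneg (m : ℕ) (s : SideState) : 0 ≤ lasting m s := by
  have := lineRate_pos m
  unfold lasting
  split_ifs <;> positivity

theorem lasting_le_one (m : ℕ) (s : SideState) : lasting m s ≤ 1 := by
  unfold lasting
  split_ifs
  · exact le_rfl
  · have h1 : lineRate m ^ (m ^ 2 - s.M) ≤ 1 :=
      pow_le_one₀ (lineRate_pos m).le (lineRate_le_one m)
    have h2 : max 0 (headingProfile m s.y s.d) ≤ 3 := max_le (by norm_num) (headingProfile_le _ _ _)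
    have h3 : (0 : ℝ) ≤ max 0 (headingProfile m s.y s.d) := le_max_left _ _
    have h4 := pow_pos (lineRate_pos m) (m ^ 2 - s.M)
    nlinarith
  · exact zero_le_one

/-- `lasting` during the excursion number `j`, and whether the excursion has lasted long enough
afterwards. -/
noncomputable def lastingFrom (m j : ℕ) (s : SideState) : ℝ :=
  if s.j = j then lasting m s else if m ^ 2 ≤ s.L then 1 else 0

theorem lastingFrom_nonneg (m j : ℕ) (s : SideState) : 0 ≤ lastingFrom m j s := by
  unfold lastingFrom
  split_ifs
  exacts [lasting_nonneg m s, zero_le_one, le_rfl]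

theorem lastingFrom_exit (m : ℕ) (s : SideState) :
    lastingFrom m s.j s.exit = if m ^ 2 ≤ s.M then 1 else 0 := by
  exact if_neg (Nat.succ_ne_self _)

theorem lastingFrom_of_eq {m j : ℕ} {s : SideState} (h : s.j = j) :
    lastingFrom m j s = lasting m s := if_pos h

/-- A submartingale inequality: the sine profile is an exact eigenfunction inside, and truncation at
0 and at the two ends only goes in the favourable direction. As `m ≤ s.L`, the killing barrier comes
no later than the far end. -/
theorem numNext_mul_lasting_le {m : ℕ} {s : SideState} (hm : 2 ≤ m) (hL : m ≤ s.L) :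
    s.numNext * lasting m s ≤ sumNext (lastingFrom m s.j) s := by
  have hnn := lastingFrom_nonneg m s.j
  by_cases hM : m ^ 2 ≤ s.M
  · have h1 : lasting m s = 1 := if_pos hM
    have hex : lastingFrom m s.j s.exit = 1 := by rw [lastingFrom_exit, if_pos hM]
    have hout : lastingFrom m s.j s.out = 1 := by
      rw [lastingFrom_of_eq (j := s.j) (s := s.out) rfl]
      exact if_pos (by simp only [out]; omega)
    have hf : lastingFrom m s.j s.forward = 1 := by
      unfold forward
      split_ifs
      · simp only [lastingFrom, lasting, if_true, if_pos hM]
      · exact hex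
    have hb : lastingFrom m s.j s.backward = 1 := by
      unfold backward
      split_ifs
      · exact hex
      · simp only [lastingFrom, lasting, if_true, if_pos hM]
    rw [h1, ← sumNext_const]
    exact sumNext_mono hout.ge hf.ge hb.ge
  by_cases hy : s.y + 1 < m
  swap
  · rw [lasting, if_neg hM, if_neg hy, ← sumNext_const]
    exact sumNext_mono (hnn _) (hnn _) (hnn _)
  have hm0 : 0 < m := by omega
  have hmR : (0 : ℝ) < m := by exact_mod_cast hm0
  have hyR : (s.y : ℝ) + 2 ≤ m := by exact_mod_cast (by omega : s.y + 2 ≤ m)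
  have hy0 : (0 : ℝ) ≤ s.y := by positivity
  set b := lineRate m ^ (m ^ 2 - s.M) with hb
  have hb0 : 0 < b := pow_pos (lineRate_pos m) _
  have hp1 : 0 ≤ profile m (s.y + 1) := profile_nonneg hm0 (by linarith) (by linarith)
  have hid := profile_add m s.y
  have hbpred : lineRate m ^ (m ^ 2 - (s.M + 1)) = b * (5 - 4 * Real.cos (Real.pi / m)) := by
    have : m ^ 2 - s.M = (m ^ 2 - (s.M + 1)) + 1 := by omega
    have h1 := one_le_inv_lineRate m
    have h2 : lineRate m * (5 - 4 * Real.cos (Real.pi / m)) = 1 :=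
      inv_mul_cancel₀ (by linarith)
    rw [hb, this, pow_succ _ (m ^ 2 - (s.M + 1)), mul_assoc, h2, mul_one]
  have hout : 1 / 3 * (b * (5 - 4 * Real.cos (Real.pi / m))) * profile m (s.y + 1) ≤
      lastingFrom m s.j s.out := by
    rw [lastingFrom_of_eq (j := s.j) (s := s.out) rfl, lasting, ← hbpred, if_pos (c := s.out.y + 1 < m) hy]
    split_ifs with h
    · simp only [out] at h
      have : m ^ 2 - (s.M + 1) = 0 := by omega
      rw [this, pow_zero]
      have := Real.sin_le_one (Real.pi / m * (s.y + 1))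
      unfold profile
      linarith
    · change _ ≤ 1 / 3 * lineRate m ^ (m ^ 2 - (s.M + 1)) * max 0 (profile m (s.y + 1))
      rw [max_eq_right hp1]
  have hfwd : 1 / 3 * b * (2 * profile m (s.y + 2) - profile m (s.y + 1)) ≤
      lastingFrom m s.j s.forward := by
    simp only [forward, if_pos (hy.trans_le hL), lastingFrom, lasting, if_true, if_neg hM]
    split_ifs with h
    · refine mul_le_mul_of_nonneg_left (le_max_of_le_right ?_) (by positivity)
      simp only [headingProfile]
      push_cast
      rw [show (s.y : ℝ) + 1 + 1 = s.y + 2 by ring]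
    -- The forward step hits the barrier: `lasting` becomes 0, while the sine vanishes at `m` and
    -- makes the required lower bound nonpositive.
    · have h2 : (s.y : ℝ) + 2 = m := by exact_mod_cast (by omega : s.y + 2 = m)
      have h3 : profile m (s.y + 2) = 0 := by
        rw [profile, h2, div_mul_cancel₀ _ hmR.ne', Real.sin_pi]
      rw [h3]
      nlinarith
  have hbwd : 1 / 3 * b * (2 * profile m s.y - profile m (s.y + 1)) ≤
      lastingFrom m s.j s.backward := by
    rcases Nat.eq_zero_or_pos s.y with h0 | h0
    · refine le_trans ?_ (hnn _)
      have h3 : profile m s.y = 0 := by simp [profile, h0]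
      rw [h3]
      nlinarith
    · obtain ⟨k, hk⟩ := Nat.exists_eq_add_of_le' h0
      have hk' : s.y - 1 = k := by omega
      simp only [backward, if_neg h0.ne', lastingFrom, lasting, if_true, if_neg hM, hk']
      rw [if_pos (by omega)]
      refine mul_le_mul_of_nonneg_left (le_max_of_le_right ?_) (by positivity)
      simp only [headingProfile, hk]
      push_cast
      rw [show (k : ℝ) + 1 + 1 = k + 2 by ring]
  have hval : lasting m s = 1 / 3 * b * max 0 (headingProfile m s.y s.d) := by
    rw [lasting, if_neg hM, if_pos hy]
  rw [hval]
  set c := Real.cos (Real.pi / m)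
  set p0 := profile m s.y
  set p1 := profile m (s.y + 1)
  set p2 := profile m (s.y + 2)
  have hcomb : 1 / 3 * b * ((5 - 4 * c) * p1 + (2 * p2 - p1)) = 2 * (1 / 3 * b * (2 * p1 - p0)) := by
    linear_combination (2 / 3 * b) * hid
  have hcomb' : 1 / 3 * b * ((5 - 4 * c) * p1 + (2 * p0 - p1)) =
      2 * (1 / 3 * b * (2 * p1 - p2)) := by
    linear_combination (2 / 3 * b) * hid
  have hcomb3 : 1 / 3 * b * ((5 - 4 * c) * p1 + (2 * p2 - p1) + (2 * p0 - p1)) =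
      3 * (1 / 3 * b * p1) := by
    linear_combination (2 / 3 * b) * hid
  rcases hd : s.d with _ | _ | _ <;> simp only [numNext, sumNext, headingProfile, hd]
  · change 3 * (1 / 3 * b * max 0 p1) ≤ _
    rw [max_eq_right hp1]
    linarith
  · change 2 * (1 / 3 * b * max 0 (2 * p1 - p0)) ≤ _
    rcases le_total (2 * p1 - p0) 0 with h | h
    · rw [max_eq_left h]
      linarith [hnn s.out, hnn s.forward]
    · rw [max_eq_right h]
      linarith
  · change 2 * (1 / 3 * b * max 0 (2 * p1 - p2)) ≤ _
    rcases le_total (2 * p1 - p2) 0 with h | h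
    · rw [max_eq_left h]
      linarith [hnn s.out, hnn s.backward]
    · rw [max_eq_right h]
      linarith

/-- The constant in the lower bound for the probability of a long excursion. -/
noncomputable def lastingConst : ℝ := 2 / 3 * Real.exp (-(2 * Real.pi ^ 2))

theorem lastingConst_pos : 0 < lastingConst := by unfold lastingConst; positivity

theorem lastingConst_lt_one : lastingConst < 1 := by
  have : Real.exp (-(2 * Real.pi ^ 2)) ≤ 1 := Real.exp_le_one_iff.2 (by have := Real.pi_pos; nlinarith)
  unfold lastingConst
  linarith

/-- With `x = π / m`, `5 - 4 * cos x ≤ 1 + 2 * x ^ 2 ≤ exp (2 * x ^ 2)`: surviving `m ^ 2` lines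
costs only a constant factor. -/
theorem exp_le_lineRate_pow {m : ℕ} (hm : 0 < m) :
    Real.exp (-(2 * Real.pi ^ 2)) ≤ lineRate m ^ m ^ 2 := by
  have hmR : (m : ℝ) ≠ 0 := by exact_mod_cast hm.ne'
  have h1 : 5 - 4 * Real.cos (Real.pi / m) ≤ Real.exp (2 * (Real.pi / m) ^ 2) := by
    have h2 := Real.one_sub_sq_div_two_le_cos (x := Real.pi / m)
    have h3 := Real.add_one_le_exp (2 * (Real.pi / m) ^ 2)
    linarith
  have h2 : Real.exp (-(2 * (Real.pi / m) ^ 2)) ≤ lineRate m := by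
    rw [Real.exp_neg]
    exact inv_anti₀ (zero_lt_one.trans_le (one_le_inv_lineRate m)) h1
  calc Real.exp (-(2 * Real.pi ^ 2)) = Real.exp (-(2 * (Real.pi / m) ^ 2)) ^ m ^ 2 := by
        rw [← Real.exp_nat_mul]
        congr 1
        push_cast
        field_simp
    _ ≤ _ := pow_le_pow_left₀ (Real.exp_pos _).le h2 _

/-- The success probability of one trial: next to the corner the profile is `sin (π / m)`, at least
`2 / m` by concavity. -/
theorem lastingConst_div_le {m : ℕ} (hm : 2 ≤ m) {s : SideState} (hy : s.y = 0)
    (hd : s.d = .fresh) : lastingConst / m ≤ lasting m s := by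
  have hmR : (2 : ℝ) ≤ m := by exact_mod_cast hm
  unfold lasting
  split_ifs with h1 h2
  · rw [div_le_one (by linarith)]
    linarith [lastingConst_lt_one]
  · have h3 : 2 / (m : ℝ) ≤ profile m (s.y + 1) := by
      have : Real.pi / m ≤ Real.pi / 2 := div_le_div_of_nonneg_left Real.pi_pos.le (by norm_num) hmR
      have h := Real.mul_le_sin (x := Real.pi / m) (by positivity) this
      simp only [profile, hy, Nat.cast_zero, zero_add, mul_one]
      refine le_trans (le_of_eq ?_) h
      have := Real.pi_ne_zero
      field_simp
    have h4 : Real.exp (-(2 * Real.pi ^ 2)) ≤ lineRate m ^ (m ^ 2 - s.M) :=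
      (exp_le_lineRate_pow (by omega)).trans
        (pow_le_pow_of_le_one (lineRate_pos m).le (lineRate_le_one m) (Nat.sub_le _ _))
    rw [hd]
    calc lastingConst / m = 1 / 3 * Real.exp (-(2 * Real.pi ^ 2)) * (2 / m) := by
          unfold lastingConst; ring
      _ ≤ 1 / 3 * lineRate m ^ (m ^ 2 - s.M) * max 0 (headingProfile m s.y .fresh) :=
          mul_le_mul (by linarith) (h3.trans (le_max_right _ _)) (by positivity)
            (by have := lineRate_pos m; positivity)
  · omega

/-- A bound for the probability that the excursion number `J` reaches the far end of its side. -/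
noncomputable def farPotential (J m : ℕ) (s : SideState) : ℝ :=
  if J < s.j then 0
  else if s.j = J then s.crossPotential
  else 2 / (m : ℝ) ^ 2 +
    -- To the cost `2 / m ^ 2` of crossing a long side is added a bound for the probability that all
    -- trials fail. Trials are the excursions `j ≥ 2 * m` with `J - j` odd, during which the future
    -- side of excursion `J` grows. The power counts the trials not yet begun; the last factor is
    -- the failure of the current trial, or the fact that the side is still short.
    if s.j < 2 * m then (1 - lastingConst / m) ^ ((J - 2 * m) / 2)
    else (1 - lastingConst / m) ^ ((J - s.j) / 2) *
      if (J - s.j) % 2 = 1 then 1 - lasting m s else if s.L < m ^ 2 then 1 else 0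

section

variable {J m : ℕ} {s : SideState}

theorem one_sub_nonneg (hm : 2 ≤ m) : 0 ≤ 1 - lastingConst / m := by
  have hmR : (2 : ℝ) ≤ m := by exact_mod_cast hm
  rw [sub_nonneg, div_le_one (by linarith)]
  linarith [lastingConst_lt_one]

theorem farPotential_nonneg (hm : 2 ≤ m) : 0 ≤ farPotential J m s := by
  have h1 := one_sub_nonneg hm
  have h2 := lasting_le_one m s
  unfold farPotential
  split_ifs
  · exact le_rfl
  · exact crossPotential_nonneg s
  · positivity
  · have : 0 ≤ 1 - lasting m s := by linarith
    positivity
  · positivity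
  · simp; positivity

theorem sumNext_farPotential_le_of_even (hm : 2 ≤ m) (h2m : 2 * m ≤ s.j) (hj : s.j < J)
    (hpar : (J - s.j) % 2 = 0) :
    sumNext (farPotential J m) s ≤ s.numNext * farPotential J m s := by
  have hmR : (2 : ℝ) ≤ m := by exact_mod_cast hm
  have h1 := one_sub_nonneg hm
  have hval : ∀ s' : SideState, s'.j = s.j → s'.L = s.L →
      farPotential J m s' = farPotential J m s := by
    intro s' e1 e2
    simp only [farPotential, e1, e2, if_neg hj.le.not_gt, if_neg hj.ne, if_neg h2m.not_gt, hpar,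
      zero_ne_one, if_false]
  have hex : farPotential J m s.exit ≤ farPotential J m s := by
    have e : s.exit.j = s.j + 1 := rfl
    simp only [farPotential, e, if_neg hj.le.not_gt, if_neg hj.ne, if_neg h2m.not_gt, hpar,
      zero_ne_one, if_false]
    rw [if_neg (by omega), if_neg (by omega), if_neg (by omega), if_pos (by omega)]
    gcongr 2 / (m : ℝ) ^ 2 + ?_
    split_ifs with hL
    -- The exit starts a trial: one factor of the power is exchanged for the actual failure
    -- probability.
    · have e2 : (J - s.j) / 2 = (J - (s.j + 1)) / 2 + 1 := by omega
      rw [e2, pow_succ, mul_one]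
      have := lastingConst_div_le hm (s := s.exit) rfl rfl
      gcongr
    · have : lasting m s.exit = 1 := if_pos (by simp only [exit]; omega)
      rw [this]; simp
  rw [← sumNext_const]
  exact sumNext_mono_of_exit (fun s' h h' => (hval s' h h').le) hex

theorem sumNext_farPotential_le_of_odd (hm : 2 ≤ m) (h2m : 2 * m ≤ s.j) (hj : s.j < J)
    (hpar : (J - s.j) % 2 = 1) (hs : s.Valid) :
    sumNext (farPotential J m) s ≤ s.numNext * farPotential J m s := by
  have h1 := one_sub_nonneg hm
  set a : ℝ := 2 / (m : ℝ) ^ 2 with ha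
  set b : ℝ := (1 - lastingConst / m) ^ ((J - s.j) / 2) with hb
  have hb0 : 0 ≤ b := pow_nonneg h1 _
  have ha0 : 0 ≤ a := by positivity
  have hval : ∀ s' : SideState, s'.j = s.j →
      farPotential J m s' = a + b * (1 - lastingFrom m s.j s') := by
    intro s' e1
    simp only [farPotential, e1, if_neg hj.le.not_gt, if_neg hj.ne, if_neg h2m.not_gt, hpar,
      if_true, lastingFrom]
    rfl
  have hex : farPotential J m s.exit ≤ a + b * (1 - lastingFrom m s.j s.exit) := by
    have e : s.exit.j = s.j + 1 := rfl
    rw [lastingFrom_exit]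
    simp only [farPotential, e]
    rw [if_neg (by omega)]
    split_ifs with h2 h3 h4 h5 h6 h7 h8 h9 h10
    · -- the next excursion is the last one and starts from a long side
      have hMR : (m : ℝ) ^ 2 ≤ s.M := by exact_mod_cast h3
      have hm0 : (0 : ℝ) < (m : ℝ) ^ 2 := by have : 0 < m := by omega
                                             positivity
      simp only [crossPotential, exit, Nat.cast_zero, zero_add, sub_self, mul_zero, add_zero]
      exact div_le_div_of_nonneg_left (by norm_num) hm0 hMR
    -- The last trial has failed; the potential available is then at least 1, which covers `2 /
    -- s.M`.
    · have hM : (2 : ℝ) ≤ s.M := by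
        have := hs.le_M
        exact_mod_cast (by omega : 2 ≤ s.M)
      have hb1 : b = 1 := by
        rw [hb, show (J - s.j) / 2 = 0 by omega, pow_zero]
      simp only [crossPotential, exit, Nat.cast_zero, zero_add, sub_zero, mul_one, hb1]
      have : 2 / (s.M : ℝ) ≤ 1 := by rw [div_le_one (by linarith)]; exact hM
      linarith
    all_goals first
      | omega
      | (simp only [exit] at *; omega)
      | (have e2 : (J - (s.j + 1)) / 2 = (J - s.j) / 2 := by omega
         rw [e2, ← hb]; simp [ha])
  have key : sumNext (farPotential J m) s ≤
      sumNext (fun s' => a + b * (1 - lastingFrom m s.j s')) s :=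
    sumNext_mono_of_exit (fun s' h _ => (hval s' h).le) hex
  refine key.trans ?_
  have hL : m ≤ s.L := by have := hs.le_L; omega
  have hlast := numNext_mul_lasting_le hm hL
  rw [sumNext_affine, hval s rfl]
  have : lastingFrom m s.j s = lasting m s := if_pos rfl
  rw [this]
  nlinarith

theorem sumNext_farPotential_le (hm : 2 ≤ m) (hJ : 2 * m < J) (hs : s.Valid)
    (hB : ¬ (s.j = J ∧ s.y + 1 = s.L)) :
    sumNext (farPotential J m) s ≤ s.numNext * farPotential J m s := by
  have hy := hs.y_lt
  rcases lt_trichotomy s.j J with hj | hj | hj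
  · rcases Nat.lt_or_ge s.j (2 * m) with h2m | h2m
    · have h1 := one_sub_nonneg hm
      have hval : ∀ s' : SideState, s'.j = s.j → farPotential J m s' = farPotential J m s := by
        intro s' e1
        simp only [farPotential, e1, if_neg hj.le.not_gt, if_neg hj.ne, if_pos h2m]
      have hex : farPotential J m s.exit ≤ farPotential J m s := by
        have e : s.exit.j = s.j + 1 := rfl
        simp only [farPotential, e, if_neg hj.le.not_gt, if_neg hj.ne, if_pos h2m]
        rw [if_neg (by omega), if_neg (by omega)]
        gcongr 2 / (m : ℝ) ^ 2 + ?_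
        split_ifs with h3 h4 h5
        · exact le_rfl
        all_goals rw [show J - (s.j + 1) = J - 2 * m by omega]
        · refine mul_le_of_le_one_right (by positivity) ?_
          linarith [lasting_nonneg m s.exit]
        · simp
        · simp only [mul_zero]; positivity
      rw [← sumNext_const]
      exact sumNext_mono_of_exit (fun s' h _ => (hval s' h).le) hex
    · rcases Nat.mod_two_eq_zero_or_one (J - s.j) with hpar | hpar
      · exact sumNext_farPotential_le_of_even hm h2m hj hpar
      · exact sumNext_farPotential_le_of_odd hm h2m hj hpar hs
  · have h1 : farPotential J m s = s.crossPotential := by simp [farPotential, hj]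
    rw [h1]
    refine sumNext_crossPotential_le (by omega) (fun s' e => ?_) ?_
    · simp [farPotential, e, hj]
    · simp [farPotential, exit, hj]
  · have hval : ∀ s' : SideState, s.j ≤ s'.j → farPotential J m s' = 0 :=
      fun s' h => if_pos (by omega)
    rw [hval s le_rfl, ← sumNext_const]
    exact sumNext_mono_of_exit (fun s' h _ => (hval s' h.ge).le) (hval _ (Nat.le_succ _)).le

theorem farPotential_init (hm : 2 ≤ m) (hJ : 2 * m < J) (h0 : s.j = 0) :
    farPotential J m s = 2 / (m : ℝ) ^ 2 + (1 - lastingConst / m) ^ ((J - 2 * m) / 2) := by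
  simp only [farPotential, h0]
  rw [if_neg (by omega), if_neg (by omega), if_pos (by omega)]

end

/-- A concave profile for the expected duration of an excursion. -/
def parabola (L x : ℝ) : ℝ := (x + 3) * (L + 2 - x)

/-- A bound for the expected time spent in the excursion number `J` when its side has
length `L`. -/
noncomputable def durationPotential (J L : ℕ) (s : SideState) : ℝ :=
  if J < s.j then 0
  else if s.j = J ∧ s.L = L then
    match s.d with
    | .fresh => parabola L s.y
    | .fwd => parabola L (s.y + 1) + 2
    | .bwd => parabola L (s.y - 1) + 2
  else ((L : ℝ) + 4) ^ 2

theorem durationPotential_nonneg (J L : ℕ) {s : SideState} (hs : s.y < s.L) :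
    0 ≤ durationPotential J L s := by
  unfold durationPotential
  split_ifs with h1 h2
  · exact le_rfl
  · have hy : (s.y : ℝ) + 1 ≤ L := by exact_mod_cast (by omega : s.y + 1 ≤ L)
    have hy0 : (0 : ℝ) ≤ s.y := by positivity
    split <;> unfold parabola <;> nlinarith
  · positivity

theorem durationPotential_le (J L : ℕ) {s : SideState} (hs : s.y < s.L) :
    durationPotential J L s ≤ ((L : ℝ) + 4) ^ 2 := by
  unfold durationPotential
  split_ifs with h1 h2
  · positivity
  · have hy : (s.y : ℝ) + 1 ≤ L := by exact_mod_cast (by omega : s.y + 1 ≤ L)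
    have hy0 : (0 : ℝ) ≤ s.y := by positivity
    split <;> unfold parabola <;> nlinarith
  · exact le_rfl

/-- The second difference of `parabola` pays for each unit of time spent in the excursion. Before
it, the constant `(L + 4) ^ 2` dominates every value the potential can take. -/
theorem sumNext_durationPotential_le (J L : ℕ) {s : SideState} (hs : s.Valid) :
    sumNext (durationPotential J L) s + s.numNext * (if s.j = J ∧ s.L = L then 1 else 0) ≤
      s.numNext * durationPotential J L s := by
  by_cases hD : s.j = J ∧ s.L = L
  · obtain ⟨hj, hL⟩ := hD
    have hlt := hs.y_lt
    have hy : (s.y : ℝ) + 1 ≤ L := by exact_mod_cast (by omega : s.y + 1 ≤ L)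
    have hy0 : (0 : ℝ) ≤ s.y := by positivity
    have hex : durationPotential J L s.exit = 0 := by simp [durationPotential, exit, hj]
    have hout : durationPotential J L s.out = parabola L s.y := by
      simp [durationPotential, out, hj, hL]
    have hfwd : durationPotential J L s.forward ≤ parabola L (s.y + 2) + 2 := by
      unfold forward
      split_ifs
      · simp only [durationPotential, hj, hL, lt_irrefl, if_false, and_self, if_true, Nat.cast_add,
          Nat.cast_one, add_assoc]
        norm_num
      · rw [hex]; unfold parabola; nlinarith
    have hbwd : durationPotential J L s.backward ≤ parabola L (s.y - 2) + 2 := by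
      unfold backward
      split_ifs with h0
      · rw [hex]; unfold parabola; rw [h0] at *; push_cast at *; nlinarith
      · obtain ⟨k, hk⟩ := Nat.exists_eq_succ_of_ne_zero h0
        simp only [durationPotential, hj, hL, lt_irrefl, if_false, and_self, if_true, hk,
          Nat.succ_sub_one, Nat.cast_succ]
        rw [show (k : ℝ) + 1 - 2 = k - 1 by ring]
    rw [if_pos ⟨hj, hL⟩]
    have hself : durationPotential J L s = match s.d with
        | .fresh => parabola L s.y
        | .fwd => parabola L (s.y + 1) + 2
        | .bwd => parabola L (s.y - 1) + 2 := by
      simp only [durationPotential, hj, hL, lt_irrefl, if_false, and_self, if_true]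
    rw [hself]
    rcases hd : s.d with _ | _ | _ <;> simp only [sumNext, numNext, hd, hout] <;>
      unfold parabola at * <;> nlinarith
  · rw [if_neg hD, mul_zero, add_zero, ← sumNext_const]
    rcases Nat.lt_or_ge J s.j with hj | hj
    · have hval : ∀ s' : SideState, s.j ≤ s'.j → durationPotential J L s' = 0 :=
        fun s' h => if_pos (by omega)
      rw [hval s le_rfl]
      exact sumNext_mono_of_exit (fun s' h _ => (hval s' h.ge).le) (hval _ (Nat.le_succ _)).le
    · have : durationPotential J L s = ((L : ℝ) + 4) ^ 2 := by
        simp only [durationPotential, if_neg hj.not_gt, if_neg hD]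
      rw [this]
      exact sumNext_mono (durationPotential_le J L hs.out.y_lt)
        (durationPotential_le J L hs.forward.y_lt) (durationPotential_le J L hs.backward.y_lt)

end SideState

/-! ### From potentials to probabilities. -/

theorem State.step_s (σ : State) (e : ℤ × ℤ) :
    (σ.step e).s = σ.s.out ∨ (σ.step e).s = σ.s.forward ∨ (σ.step e).s = σ.s.backward := by
  unfold State.step SideState.forward SideState.backward
  split_ifs <;> simp

theorem valid_stateAt {p : Path} {t : ℕ} (ht : 1 ≤ t) : (stateAt p t).s.Valid := by
  induction t, ht using Nat.le_induction with
  | base => constructor <;> simp [stateAt, initState]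
  | succ t ht ih =>
    rw [stateAt_succ p ht]
    rcases (stateAt p t).step_s (p (t + 1) - p t) with h | h | h <;> rw [h]
    exacts [ih.out, ih.forward, ih.backward]

theorem stateAt_extend (p : Path) {t : ℕ} (ht : 1 ≤ t) (e : ℤ × ℤ) :
    stateAt (extend p t e) (t + 1) = (stateAt p t).step e := by
  rw [stateAt_succ _ ht, extend_succ, extend_of_le _ _ le_rfl, add_sub_cancel_left,
    stateAt_congr fun s hs => extend_of_le p e hs]

section Walk

variable {Ω : Type*} [MeasurableSpace Ω] {P : Measure Ω} {γ : ℕ → Ω → ℤ × ℤ}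

theorem IsPrudentWalk.measurableSet_stateAt (hγ : IsPrudentWalk P γ) (B : Set SideState) (t : ℕ) :
    MeasurableSet {ω | (stateAt (fun s => γ s ω) t).s ∈ B} := by
  have : DeterminedBy (fun p => (stateAt p t).s ∈ B) t := fun p q h => by
    simp only [stateAt_congr h]
  exact measurableSet_setOfPred.2 (hγ.measurable_comp this)

/-- The potential stopped on visiting `B` is a supermartingale; Markov's inequality at level 1
bounds the probability of a visit before each fixed time, and time then tends to infinity. -/
theorem IsPrudentWalk.measure_exists_stateAt_le [IsProbabilityMeasure P] (hγ : IsPrudentWalk P γ)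
    {h : SideState → ℝ} {B : Set SideState} {c : ℝ} (h0 : ∀ s, 0 ≤ h s) (hB : ∀ s ∈ B, 1 ≤ h s)
    (hh : ∀ s : SideState, s.Valid → s ∉ B → s.sumNext h ≤ s.numNext * h s)
    (hc : h ⟨0, 1, 2, 0, .fresh⟩ ≤ c) :
    P {ω | ∃ t, 1 ≤ t ∧ (stateAt (fun s => γ s ω) t).s ∈ B} ≤ ENNReal.ofReal c := by
  classical
  -- Visits are strictly before `t`: at the first visit the process still equals `h ≥ 1`, and it is
  -- frozen at 1 one step later.
  let N : ℕ → Path → Prop := fun t p => ∃ r, 1 ≤ r ∧ r < t ∧ (stateAt p r).s ∈ B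
  let G : ℕ → Path → ℝ := fun t p => if N t p then 1 else h (stateAt p t).s
  have hN : ∀ t {p q : Path}, (∀ s ≤ t, p s = q s) → (N t p ↔ N t q) := by
    intro t p q hpq
    refine exists_congr fun r => and_congr_right fun _ => and_congr_right fun hr => ?_
    rw [stateAt_congr fun s hs => hpq s (hs.trans hr.le)]
  have hG : ∀ t, DeterminedBy (G t) t := by
    intro t p q hpq
    simp only [G, hN t hpq, stateAt_congr hpq]
  have hG0 : ∀ t p, 0 ≤ G t p := by
    intro t p
    simp only [G]
    split_ifs
    exacts [zero_le_one, h0 _]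
  have hsucc : ∀ t, 1 ≤ t → ∀ p e, N (t + 1) (extend p t e) ↔ N t p ∨ (stateAt p t).s ∈ B := by
    intro t ht p e
    constructor
    · rintro ⟨r, hr1, hr2, hr3⟩
      rw [stateAt_congr fun s hs => extend_of_le p e (hs.trans (Nat.le_of_lt_succ hr2))] at hr3
      rcases (Nat.le_of_lt_succ hr2).lt_or_eq with h | rfl
      · exact .inl ⟨r, hr1, h, hr3⟩
      · exact .inr hr3
    · rintro (⟨r, hr1, hr2, hr3⟩ | hB)
      · refine ⟨r, hr1, by omega, ?_⟩
        rwa [stateAt_congr fun s hs => extend_of_le p e (hs.trans hr2.le)]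
      · refine ⟨t, ht, by omega, ?_⟩
        rwa [stateAt_congr fun s hs => extend_of_le p e hs]
  have hstep : ∀ t, 1 ≤ t → ∀ p, PrudentUpTo p t →
      ∑ e ∈ allowedDirs p t, G (t + 1) (extend p t e) ≤ (allowedDirs p t).card * G t p := by
    intro t ht p hp
    by_cases hN' : N t p ∨ (stateAt p t).s ∈ B
    · have h1 : 1 ≤ G t p := by
        simp only [G]
        split_ifs with h
        · exact le_rfl
        · exact hB _ (hN'.resolve_left h)
      have h2 : ∀ e, G (t + 1) (extend p t e) = 1 := fun e => if_pos ((hsucc t ht p e).2 hN')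
      simp only [h2, Finset.sum_const, nsmul_eq_mul, mul_one]
      nlinarith [Nat.cast_nonneg (α := ℝ) (allowedDirs p t).card]
    · have h1 : G t p = h (stateAt p t).s := if_neg fun h => hN' (.inl h)
      have h2 : ∀ e, G (t + 1) (extend p t e) = h ((stateAt p t).step e).s := fun e => by
        rw [← stateAt_extend p ht e]
        exact if_neg ((hsucc t ht p e).not.2 hN')
      obtain ⟨h3, h4⟩ := (hp.describes ht).sum_allowedDirs h
      simp only [h1, h2, h3, h4]
      exact hh _ (valid_stateAt ht) fun h => hN' (.inr h)
  have hunion : {ω | ∃ t, 1 ≤ t ∧ (stateAt (fun s => γ s ω) t).s ∈ B} =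
      ⋃ t, {ω | N t fun s => γ s ω} := by
    ext ω
    simp only [Set.mem_iUnion, Set.mem_ofPred_eq, N]
    constructor
    · rintro ⟨t, h1, h2⟩; exact ⟨t + 1, t, h1, by omega, h2⟩
    · rintro ⟨_, t, h1, -, h2⟩; exact ⟨t, h1, h2⟩
  have hmono : Monotone fun t => {ω | N t fun s => γ s ω} := by
    rintro a b hab ω ⟨r, h1, h2, h3⟩
    exact ⟨r, h1, h2.trans_le hab, h3⟩
  rw [hunion, hmono.measure_iUnion]
  refine iSup_le fun t => ?_
  refine (measure_mono (hmono (Nat.le_succ t))).trans ?_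
  have hmeas : Measurable fun ω => ENNReal.ofReal (G (t + 1) fun s => γ s ω) :=
    ENNReal.measurable_ofReal.comp (hγ.measurable_comp (hG (t + 1)))
  have hmarkov := mul_meas_ge_le_lintegral (μ := P) hmeas 1
  rw [one_mul] at hmarkov
  calc P {ω | N (t + 1) fun s => γ s ω}
      ≤ P {ω | 1 ≤ ENNReal.ofReal (G (t + 1) fun s => γ s ω)} := by
        refine measure_mono fun ω hω => ?_
        have : G (t + 1) (fun s => γ s ω) = 1 := if_pos hω
        simp [this]
    _ ≤ ∫⁻ ω, ENNReal.ofReal (G (t + 1) fun s => γ s ω) ∂P := hmarkov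
    _ ≤ ∫⁻ ω, ENNReal.ofReal (G 1 fun s => γ s ω) ∂P :=
        hγ.lintegral_supermartingale hG (fun t _ p _ => hG0 t p) hstep (t + 1) (by omega)
    _ ≤ ∫⁻ _, ENNReal.ofReal c ∂P := by
        refine lintegral_mono fun ω => ENNReal.ofReal_le_ofReal ?_
        have : G 1 (fun s => γ s ω) = h ⟨0, 1, 2, 0, .fresh⟩ :=
          if_neg (by rintro ⟨r, h1, h2, -⟩; omega)
        rw [this]
        exact hc
    _ = ENNReal.ofReal c := by simp

/-- The potential plus the time already spent in `D` is a supermartingale, so the expected number of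
visits to `D` is finite and Borel–Cantelli applies. -/
theorem IsPrudentWalk.ae_eventually_stateAt_notMem [IsProbabilityMeasure P]
    (hγ : IsPrudentWalk P γ) {h : SideState → ℝ} {D : Set SideState} [DecidablePred (· ∈ D)]
    (h0 : ∀ s : SideState, s.Valid → 0 ≤ h s)
    (hh : ∀ s : SideState, s.Valid →
      s.sumNext h + s.numNext * (if s ∈ D then 1 else 0) ≤ s.numNext * h s) :
    ∀ᵐ ω ∂P, ∀ᶠ t in atTop, (stateAt (fun s => γ s ω) t).s ∉ D := by
  let I : Path → ℕ → ℝ := fun p r => if (stateAt p r).s ∈ D then 1 else 0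
  let G : ℕ → Path → ℝ := fun t p => h (stateAt p t).s + ∑ r ∈ Finset.Ico 1 t, I p r
  have hI0 : ∀ p r, 0 ≤ I p r := fun p r => by simp only [I]; split_ifs <;> norm_num
  have hI : ∀ {p q : Path} {t : ℕ}, (∀ s ≤ t, p s = q s) → I p t = I q t := fun h => by
    simp only [I, stateAt_congr h]
  have hG : ∀ t, DeterminedBy (G t) t := by
    intro t p q hpq
    simp only [G, stateAt_congr hpq]
    congr 1
    refine Finset.sum_congr rfl fun r hr => hI fun s hs => hpq s ?_
    have := (Finset.mem_Ico.1 hr).2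
    omega
  have hG0 : ∀ t, 1 ≤ t → ∀ p, PrudentUpTo p t → 0 ≤ G t p := fun t ht p _ =>
    add_nonneg (h0 _ (valid_stateAt ht)) (Finset.sum_nonneg fun r _ => hI0 p r)
  have hstep : ∀ t, 1 ≤ t → ∀ p, PrudentUpTo p t →
      ∑ e ∈ allowedDirs p t, G (t + 1) (extend p t e) ≤ (allowedDirs p t).card * G t p := by
    intro t ht p hp
    have h2 : ∀ e, G (t + 1) (extend p t e) =
        h ((stateAt p t).step e).s + (∑ r ∈ Finset.Ico 1 t, I p r + I p t) := fun e => by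
      rw [← stateAt_extend p ht e, ← Finset.sum_Ico_succ_top ht]
      simp only [G]
      congr 1
      refine Finset.sum_congr rfl fun r hr => hI fun s hs => extend_of_le p e ?_
      have := (Finset.mem_Ico.1 hr).2
      omega
    obtain ⟨h3, h4⟩ := (hp.describes ht).sum_allowedDirs h
    simp only [h2, Finset.sum_add_distrib, h3, Finset.sum_const, nsmul_eq_mul, h4, G]
    have := hh _ (valid_stateAt (p := p) ht)
    simp only [I]
    linarith
  let S : ℕ → Set Ω := fun t => {ω | (stateAt (fun s => γ s ω) (t + 1)).s ∈ D}
  have hSm : ∀ t, MeasurableSet (S t) := fun t => hγ.measurableSet_stateAt D (t + 1)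
  have hsum : ∑' t, P (S t) ≤ ENNReal.ofReal (h ⟨0, 1, 2, 0, .fresh⟩) := by
    refine ENNReal.tsum_le_of_sum_range_le fun n => ?_
    calc ∑ t ∈ Finset.range n, P (S t)
        = ∑ t ∈ Finset.range n, ∫⁻ ω, (S t).indicator 1 ω ∂P :=
          Finset.sum_congr rfl fun t _ => (lintegral_indicator_one (hSm t)).symm
      _ = ∫⁻ ω, ∑ t ∈ Finset.range n, (S t).indicator 1 ω ∂P :=
          (lintegral_finsetSum _ fun t _ => measurable_one.indicator (hSm t)).symm
      _ ≤ ∫⁻ ω, ENNReal.ofReal (G (n + 1) fun s => γ s ω) ∂P := by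
          refine lintegral_mono fun ω => ?_
          have e1 : ∑ t ∈ Finset.range n, (S t).indicator (1 : Ω → ENNReal) ω =
              ENNReal.ofReal (∑ r ∈ Finset.Ico 1 (n + 1), I (fun s => γ s ω) r) := by
            rw [ENNReal.ofReal_sum_of_nonneg fun r _ => hI0 _ r, Finset.sum_Ico_eq_sum_range]
            refine Finset.sum_congr (by simp) fun t _ => ?_
            rw [add_comm 1 t]
            by_cases hD : (stateAt (fun s => γ s ω) (t + 1)).s ∈ D
            · simp [S, I, hD]
            · simp [S, I, hD]
          rw [e1]
          exact ENNReal.ofReal_le_ofReal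
            (le_add_of_nonneg_left (h0 _ (valid_stateAt (by omega))))
      _ ≤ ∫⁻ ω, ENNReal.ofReal (G 1 fun s => γ s ω) ∂P :=
          hγ.lintegral_supermartingale hG hG0 hstep (n + 1) (by omega)
      _ = ENNReal.ofReal (h ⟨0, 1, 2, 0, .fresh⟩) := by
          have : ∀ ω, G 1 (fun s => γ s ω) = h ⟨0, 1, 2, 0, .fresh⟩ := fun ω => by
            simp [G, stateAt, initState]
          simp [this]
  have := ae_eventually_notMem (μ := P) (s := S) (ne_top_of_le_ne_top ENNReal.ofReal_ne_top hsum)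
  filter_upwards [this] with ω hω
  obtain ⟨N, hN⟩ := eventually_atTop.1 hω
  refine eventually_atTop.2 ⟨N + 1, fun t ht => ?_⟩
  obtain ⟨t, rfl⟩ := Nat.exists_eq_add_of_le' (le_trans (Nat.le_add_left 1 N) ht)
  exact hN t (by omega)

/-- The states of the excursion number `J` that are at the far end of their side. -/
def farEnd (J : ℕ) : Set SideState := {s | s.j = J ∧ s.y + 1 = s.L}

theorem IsPrudentWalk.measure_farEnd_le [IsProbabilityMeasure P] (hγ : IsPrudentWalk P γ)
    {J m : ℕ} (hm : 2 ≤ m) (hJ : 2 * m < J) :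
    P {ω | ∃ t, 1 ≤ t ∧ (stateAt (fun s => γ s ω) t).s ∈ farEnd J} ≤
      ENNReal.ofReal
        (2 / (m : ℝ) ^ 2 + (1 - SideState.lastingConst / m) ^ ((J - 2 * m) / 2)) := by
  refine hγ.measure_exists_stateAt_le (h := SideState.farPotential J m)
    (fun s => SideState.farPotential_nonneg hm) ?_ ?_ (SideState.farPotential_init hm hJ rfl).le
  · rintro s ⟨h1, h2⟩
    simpa [SideState.farPotential, h1] using SideState.one_le_crossPotential h2
  · exact fun s hs hB => SideState.sumNext_farPotential_le hm hJ hs hB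

/-- With `b = J ^ (1/3)`, the choice `m = ⌈b ^ 2⌉₊` balances the requirements: `2 / m ^ 2 ≤ 2 / b ^
4`, and the power is at most `exp (-κ * b / 16)`. The threshold is `512 = 8 ^ 3`. -/
theorem exists_farEnd_bound : ∃ C : ℝ, 0 < C ∧ ∀ J : ℕ, 512 ≤ J → ∃ m : ℕ, 2 ≤ m ∧ 2 * m < J ∧
    2 / (m : ℝ) ^ 2 + (1 - SideState.lastingConst / m) ^ ((J - 2 * m) / 2) ≤
      C / (J : ℝ) ^ ((4 : ℝ) / 3) := by
  set κ := SideState.lastingConst with hκ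
  have hκ0 : 0 < κ := SideState.lastingConst_pos
  -- The second summand comes from `exp (-x) ≤ 24 / x ^ 4` at `x = κ * b / 16`.
  refine ⟨2 + 24 * 16 ^ 4 / κ ^ 4, by positivity, fun J hJ => ?_⟩
  have hJR : (512 : ℝ) ≤ J := by exact_mod_cast hJ
  set b : ℝ := (J : ℝ) ^ ((1 : ℝ) / 3) with hb
  have hb3 : b ^ 3 = J := by
    rw [hb, ← Real.rpow_natCast, ← Real.rpow_mul (by positivity)]; norm_num
  have hb4 : (J : ℝ) ^ ((4 : ℝ) / 3) = b ^ 4 := by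
    rw [hb, ← Real.rpow_natCast, ← Real.rpow_mul (by positivity)]; norm_num
  have hb0 : 0 ≤ b := by positivity
  have hb8 : 8 ≤ b := by
    by_contra! h
    have : b ^ 3 < 8 ^ 3 := pow_lt_pow_left₀ h hb0 (by norm_num)
    rw [hb3] at this
    norm_num at this
    linarith
  set m := ⌈b ^ 2⌉₊ with hmdef
  have hm1 : b ^ 2 ≤ m := Nat.le_ceil _
  have hm2 : (m : ℝ) < b ^ 2 + 1 := Nat.ceil_lt_add_one (by positivity)
  have hm3 : (m : ℝ) ≤ 2 * b ^ 2 := by nlinarith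
  have hm4 : 4 * (m : ℝ) ≤ J := by rw [← hb3]; nlinarith
  have hm4' : 4 * m ≤ J := by exact_mod_cast hm4
  have hm64 : (64 : ℝ) ≤ m := by nlinarith
  have hm64' : 64 ≤ m := by exact_mod_cast hm64
  refine ⟨m, by omega, by omega, ?_⟩
  rw [hb4, add_div]
  refine add_le_add ?_ ?_
  · rw [show b ^ 4 = (b ^ 2) ^ 2 by ring]
    gcongr
  · set n := (J - 2 * m) / 2 with hn
    have hn8 : J ≤ 8 * n := by omega
    have hn8R : (J : ℝ) ≤ 8 * n := by exact_mod_cast hn8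
    have h1 : 0 ≤ 1 - κ / m := SideState.one_sub_nonneg (by omega)
    set x : ℝ := κ * b / 16 with hx
    have hx0 : 0 < x := by positivity
    have h2 : (1 - κ / m) ^ n ≤ Real.exp (-x) := by
      calc (1 - κ / m) ^ n ≤ Real.exp (-(κ / m)) ^ n := by
            gcongr
            linarith [Real.add_one_le_exp (-(κ / m))]
        _ = Real.exp (n * -(κ / m)) := (Real.exp_nat_mul _ _).symm
        _ ≤ Real.exp (-x) := by
            rw [Real.exp_le_exp, mul_neg, neg_le_neg_iff, hx, mul_div_assoc', le_div_iff₀ (by linarith)]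
            have h3 : b * m ≤ 2 * (J : ℝ) := by rw [← hb3]; nlinarith
            nlinarith
    have h3 : x ^ 4 / 24 ≤ Real.exp x := by
      have := Real.pow_div_factorial_le_exp x hx0.le 4
      simpa [Nat.factorial] using this
    refine h2.trans ?_
    have h4 : 24 * 16 ^ 4 / κ ^ 4 / b ^ 4 = (x ^ 4 / 24)⁻¹ := by
      rw [hx]; field_simp
    rw [h4, Real.exp_neg]
    exact inv_anti₀ (by positivity) h3

theorem IsPrudentWalk.ae_forall_eventually_leave [IsProbabilityMeasure P] (hγ : IsPrudentWalk P γ) :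
    ∀ᵐ ω ∂P, ∀ J L : ℕ, ∀ᶠ t in atTop,
      ¬ ((stateAt (fun s => γ s ω) t).s.j = J ∧ (stateAt (fun s => γ s ω) t).s.L = L) := by
  rw [ae_all_iff]
  intro J
  rw [ae_all_iff]
  intro L
  exact hγ.ae_eventually_stateAt_notMem (h := SideState.durationPotential J L)
    (D := {s | s.j = J ∧ s.L = L}) (fun s hs => SideState.durationPotential_nonneg J L hs.y_lt)
    fun s hs => SideState.sumNext_durationPotential_le J L hs

end Walk

/-! ### Corners and dimensions of the rectangle, read from the state. -/

/-- `w` is a direction in which `p t` is extremal among the sites visited up to time `t`. -/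
def IsExtremal (p : Path) (t : ℕ) (w : ℤ × ℤ) : Prop := ∀ r ≤ t, dot (p r) w ≤ dot (p t) w

/-- The sign associated with an end of a side. -/
def sgn (b : Bool) : ℤ := if b then 1 else -1

theorem visitsCorner_iff (p : Path) (t : ℕ) (c : Corner) :
    VisitsCorner p t c ↔ IsExtremal p t (sgn c.1, 0) ∧ IsExtremal p t (0, sgn c.2) := by
  have hmem : ∀ (f : ℕ → ℤ) (h : ((Finset.range (t + 1)).image f).Nonempty),
      (f t = ((Finset.range (t + 1)).image f).max' h ↔ ∀ r ≤ t, f r ≤ f t) ∧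
        (f t = ((Finset.range (t + 1)).image f).min' h ↔ ∀ r ≤ t, f t ≤ f r) := by
    intro f h
    have hin : ∀ r ≤ t, f r ∈ (Finset.range (t + 1)).image f := fun r hr =>
      Finset.mem_image_of_mem f (Finset.mem_range.2 (Nat.lt_succ_of_le hr))
    refine ⟨⟨fun e r hr => e ▸ Finset.le_max' _ _ (hin r hr), fun H => ?_⟩,
      ⟨fun e r hr => e ▸ Finset.min'_le _ _ (hin r hr), fun H => ?_⟩⟩
    · refine le_antisymm (Finset.le_max' _ _ (hin t le_rfl)) (Finset.max'_le _ _ _ fun z hz => ?_)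
      obtain ⟨r, hr, rfl⟩ := Finset.mem_image.1 hz
      exact H r (Nat.le_of_lt_succ (Finset.mem_range.1 hr))
    · refine le_antisymm (Finset.le_min' _ _ _ fun z hz => ?_) (Finset.min'_le _ _ (hin t le_rfl))
      obtain ⟨r, hr, rfl⟩ := Finset.mem_image.1 hz
      exact H r (Nat.le_of_lt_succ (Finset.mem_range.1 hr))
  have hx := hmem (fun s => (p s).1) (xs_nonempty p t)
  have hy := hmem (fun s => (p s).2) (ys_nonempty p t)
  obtain ⟨a, b⟩ := c
  rw [VisitsCorner, Prod.ext_iff]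
  refine and_congr ?_ ?_
  · rcases a with _ | _
    · simpa [cornerPos, IsExtremal, sgn, dot, xs] using hx.2
    · simpa [cornerPos, IsExtremal, sgn, dot, xs] using hx.1
  · rcases b with _ | _
    · simpa [cornerPos, IsExtremal, sgn, dot, ys] using hy.2
    · simpa [cornerPos, IsExtremal, sgn, dot, ys] using hy.1

theorem AtVerticalEnd.isExtremal {p : Path} {t : ℕ} {b : Bool} (h : AtVerticalEnd p t b) :
    IsExtremal p t (0, sgn b) := by
  obtain ⟨c, hc⟩ := h
  exact ((visitsCorner_iff p t (c, b)).1 hc).2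

theorem AtHorizontalEnd.isExtremal {p : Path} {t : ℕ} {b : Bool} (h : AtHorizontalEnd p t b) :
    IsExtremal p t (sgn b, 0) := by
  obtain ⟨c, hc⟩ := h
  exact ((visitsCorner_iff p t (b, c)).1 hc).1

theorem sgn_not (b : Bool) : sgn (!b) = -sgn b := by cases b <;> rfl

theorem sgn_injective : Function.Injective sgn := by
  intro a b h
  cases a <;> cases b <;> simp [sgn] at h ⊢

namespace State.Describes

variable {σ : State} {p : Path} {t : ℕ}

theorem isExtremal_u (h : σ.Describes p t) : IsExtremal p t σ.u := h.side.X_le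

theorem not_isExtremal_neg_u (h : σ.Describes p t) : ¬ IsExtremal p t (-σ.u) := by
  intro H
  have h2 := h.side.two_le
  obtain ⟨r, hr, h1⟩ := h.side.surj_X (dot (p t) σ.u - 1) (by omega) (by omega)
  have := H r hr
  simp only [dot_neg] at this
  omega

theorem isExtremal_v_iff (h : σ.Describes p t) : IsExtremal p t σ.v ↔ σ.s.y + 1 = σ.s.L := by
  have h1 := h.side.y_lt
  constructor
  · intro H
    obtain ⟨r, hr, h2, -⟩ := h.side.surj_Y (dot (p t) σ.v - σ.s.y + σ.s.L - 1) (by omega) le_rfl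
    have := H r hr
    omega
  · intro hy r hr
    have := h.side.Y_le r hr
    omega

theorem isExtremal_neg_v_iff (h : σ.Describes p t) : IsExtremal p t (-σ.v) ↔ σ.s.y = 0 := by
  have h1 := h.side.y_lt
  simp only [IsExtremal, dot_neg]
  constructor
  · intro H
    obtain ⟨r, hr, h2, -⟩ := h.side.surj_Y (dot (p t) σ.v - σ.s.y) le_rfl (by omega)
    have := H r hr
    omega
  · intro hy r hr
    have := h.side.le_Y r hr
    omega

/-- The walk is extremal along `u`, never along `-u`, and not along `v` by `hy`; only the corner of
label `u - v`, where the excursion started, remains. -/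
theorem visitsCorner_iff_of_not_far (h : σ.Describes p t) (hy : σ.s.y + 1 ≠ σ.s.L) (c : Corner) :
    VisitsCorner p t c ↔ σ.s.y = 0 ∧ (sgn c.1, sgn c.2) = σ.u - σ.v := by
  have h1 := h.isExtremal_u
  have h2 := h.not_isExtremal_neg_u
  have h3 := h.isExtremal_v_iff.not.2 hy
  have h4 := h.isExtremal_neg_v_iff
  rw [visitsCorner_iff]
  obtain ⟨a, b⟩ := c
  rcases h.frame.cases with ⟨hu | hu, hv | hv⟩ | ⟨hu | hu, hv | hv⟩ <;>
    cases a <;> cases b <;>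
    simp only [hu, hv, sgn, Prod.neg_mk, neg_neg, neg_zero, Bool.false_eq_true, if_true,
      if_false] at h1 h2 h3 h4 ⊢ <;>
    simp [h1, h2, h3, h4]

theorem card_image_dot {w : ℤ × ℤ} {n : ℕ} {a : ℤ} (h1 : ∀ r ≤ t, a ≤ dot (p r) w)
    (h2 : ∀ r ≤ t, dot (p r) w ≤ a + n - 1)
    (h3 : ∀ z, a ≤ z → z ≤ a + n - 1 → ∃ r ≤ t, dot (p r) w = z) :
    ((Finset.range (t + 1)).image fun r => dot (p r) w).card = n := by
  have : ((Finset.range (t + 1)).image fun r => dot (p r) w) = Finset.Icc a (a + n - 1) := by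
    ext z
    simp only [Finset.mem_image, Finset.mem_range, Finset.mem_Icc, Nat.lt_succ_iff]
    constructor
    · rintro ⟨r, hr, rfl⟩; exact ⟨h1 r hr, h2 r hr⟩
    · rintro ⟨h4, h5⟩; exact h3 z h4 h5
  rw [this, Int.card_Icc]
  omega

theorem card_image_neg_dot (w : ℤ × ℤ) :
    ((Finset.range (t + 1)).image fun r => -dot (p r) w).card =
      ((Finset.range (t + 1)).image fun r => dot (p r) w).card := by
  rw [← Finset.card_image_of_injective _ (neg_injective (G := ℤ)), Finset.image_image]
  simp [Function.comp_def]

theorem width_eq {w : ℤ × ℤ} (hw : w = (1, 0) ∨ w = (-1, 0)) :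
    width p t = ((Finset.range (t + 1)).image fun r => dot (p r) w).card := by
  rcases hw with rfl | rfl
  · simp [width, xs, dot]
  · rw [← card_image_neg_dot]; simp [width, xs, dot]

theorem height_eq {w : ℤ × ℤ} (hw : w = (0, 1) ∨ w = (0, -1)) :
    height p t = ((Finset.range (t + 1)).image fun r => dot (p r) w).card := by
  rcases hw with rfl | rfl
  · simp [height, ys, dot]
  · rw [← card_image_neg_dot]; simp [height, ys, dot]

theorem card_u (h : σ.Describes p t) :
    ((Finset.range (t + 1)).image fun r => dot (p r) σ.u).card = σ.s.M :=
  card_image_dot (a := dot (p t) σ.u - σ.s.M + 1) h.side.le_X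
    (fun r hr => by have := h.side.X_le r hr; omega)
    fun z h1 h2 => h.side.surj_X z h1 (by omega)

theorem card_v (h : σ.Describes p t) :
    ((Finset.range (t + 1)).image fun r => dot (p r) σ.v).card = σ.s.L :=
  card_image_dot (a := dot (p t) σ.v - σ.s.y) h.side.le_Y h.side.Y_le
    fun z h1 h2 => by
      obtain ⟨r, hr, h3, -⟩ := h.side.surj_Y z h1 h2
      exact ⟨r, hr, h3⟩

end State.Describes

/-! ### Runs, and their behaviour under exchange of coordinates. -/

/-- A path together with its successive states. -/
structure Run (q : Path) (σ : ℕ → State) : Prop where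
  describes : ∀ t, 1 ≤ t → (σ t).Describes q t
  step_mem : ∀ t, 1 ≤ t → q (t + 1) - q t = (σ t).u ∨ q (t + 1) - q t = (σ t).v ∨
    q (t + 1) - q t = -(σ t).v
  succ : ∀ t, 1 ≤ t → σ (t + 1) = (σ t).step (q (t + 1) - q t)
  init : (σ 1).s = ⟨0, 1, 2, 0, .fresh⟩
  valid : ∀ t, 1 ≤ t → (σ t).s.Valid

theorem PrudentUpTo.run {p : Path} (hp : ∀ t, PrudentUpTo p t) : Run p (stateAt p) where
  describes t ht := (hp t).describes ht
  step_mem t ht := by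
    rcases ((hp t).describes ht).mem_allowedDirs_iff.1 ((hp (t + 1)).2 t t.lt_succ_self) with
      h | h | h
    exacts [.inl h, .inr (.inl h.1), .inr (.inr h.1)]
  succ t ht := stateAt_succ p ht
  init := rfl
  valid t ht := valid_stateAt ht

/-- The state seen after exchanging the coordinates. -/
def State.swap (σ : State) : State := ⟨σ.s, σ.u.swap, σ.v.swap⟩

theorem dot_swap (a b : ℤ × ℤ) : dot a.swap b.swap = dot a b := by
  simp only [dot, Prod.fst_swap, Prod.snd_swap]; ring

theorem State.step_swap (σ : State) (e : ℤ × ℤ) : σ.swap.step e.swap = (σ.step e).swap := by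
  unfold State.step State.swap
  simp only [Prod.swap_inj]
  split_ifs <;> rfl

/-- The notion of run is needed because `stateAt` does not commute with the exchange: `initState`
picks the direction of the side by a rotation, which the exchange reverses. -/
theorem Run.swap {q : Path} {σ : ℕ → State} (h : Run q σ) :
    Run (fun t => (q t).swap) fun t => (σ t).swap where
  describes t ht := by
    obtain ⟨h1, h2⟩ := h.describes t ht
    refine ⟨h1.swap, ?_⟩
    simpa only [State.swap, dot_swap] using h2
  step_mem t ht := by
    have := h.step_mem t ht
    rw [← Prod.swap_inj, ← Prod.swap_inj (q := (σ t).v), ← Prod.swap_inj (q := -(σ t).v)] at this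
    exact this
  succ t ht := by
    rw [h.succ t ht]
    exact (State.step_swap _ _).symm
  init := h.init
  valid := h.valid

namespace Run

variable {q : Path} {σ : ℕ → State} {t : ℕ}

theorem next (h : Run q σ) (ht : 1 ≤ t) :
    ((σ (t + 1)).s.j = (σ t).s.j ∧ (σ (t + 1)).s.L = (σ t).s.L ∧ (σ (t + 1)).u = (σ t).u ∧
        (σ (t + 1)).v = (σ t).v) ∨
      ((σ t).s.y + 1 = (σ t).s.L ∧ σ (t + 1) = ⟨(σ t).s.exit, (σ t).v, -(σ t).u⟩ ∧
        q (t + 1) = q t + (σ t).v) ∨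
      ((σ t).s.y = 0 ∧ σ (t + 1) = ⟨(σ t).s.exit, -(σ t).v, -(σ t).u⟩ ∧
        q (t + 1) = q t + -(σ t).v) := by
  have hf := (h.describes t ht).frame
  have hy := (h.valid t ht).y_lt
  rw [h.succ t ht]
  rcases h.step_mem t ht with e | e | e <;> rw [e] <;> rw [sub_eq_iff_eq_add'] at e
  · left
    simp [State.step, SideState.out]
  · simp only [State.step, if_neg hf.left_ne_right.symm, if_true]
    split_ifs with hy'
    · left
      simp [SideState.forward, hy']
    · right; left
      exact ⟨by omega, rfl, e⟩
  · simp only [State.step, if_neg hf.left_ne_neg_right.symm, if_neg hf.right_ne_neg_right.symm]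
    split_ifs with hy'
    · right; right
      exact ⟨hy', rfl, e⟩
    · left
      simp [SideState.backward, hy']

theorem exit_of_j_ne (h : Run q σ) (ht : 1 ≤ t) (hj : (σ (t + 1)).s.j ≠ (σ t).s.j) :
    (σ (t + 1)).s = (σ t).s.exit ∧ q (t + 1) = q t + (σ (t + 1)).u := by
  rcases h.next ht with ⟨h1, -⟩ | ⟨-, h2, h3⟩ | ⟨-, h2, h3⟩
  · exact absurd h1 hj
  · rw [h2]; exact ⟨rfl, h3⟩
  · rw [h2]; exact ⟨rfl, h3⟩

theorem j_succ (h : Run q σ) (ht : 1 ≤ t) :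
    (σ (t + 1)).s.j = (σ t).s.j ∨ (σ (t + 1)).s.j = (σ t).s.j + 1 := by
  by_cases hj : (σ (t + 1)).s.j = (σ t).s.j
  · exact .inl hj
  · exact .inr (by rw [(h.exit_of_j_ne ht hj).1]; rfl)

theorem const_of_j_eq (h : Run q σ) (ht : 1 ≤ t) (hj : (σ (t + 1)).s.j = (σ t).s.j) :
    (σ (t + 1)).s.L = (σ t).s.L ∧ (σ (t + 1)).v = (σ t).v := by
  rcases h.next ht with ⟨-, h1, -, h2⟩ | ⟨-, h2, -⟩ | ⟨-, h2, -⟩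
  · exact ⟨h1, h2⟩
  all_goals rw [h2] at hj; exact absurd hj (Nat.succ_ne_self _)

theorem const_of_forall_j_eq (h : Run q σ) {a b i : ℕ} (ha : 1 ≤ a) (hab : a ≤ b)
    (hj : ∀ s, a ≤ s → s ≤ b → (σ s).s.j = i) :
    (σ b).s.L = (σ a).s.L ∧ (σ b).v = (σ a).v := by
  induction b, hab using Nat.le_induction with
  | base => exact ⟨rfl, rfl⟩
  | succ b hab ih =>
    obtain ⟨h1, h2⟩ := ih fun s h1 h2 => hj s h1 (by omega)
    obtain ⟨h3, h4⟩ := h.const_of_j_eq (ha.trans hab)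
      ((hj (b + 1) (by omega) le_rfl).trans (hj b hab (by omega)).symm)
    exact ⟨h3.trans h1, h4.trans h2⟩

theorem j_mono (h : Run q σ) {a b : ℕ} (ha : 1 ≤ a) (hab : a ≤ b) : (σ a).s.j ≤ (σ b).s.j := by
  induction b, hab using Nat.le_induction with
  | base => exact le_rfl
  | succ b hab ih =>
    rcases h.j_succ (ha.trans hab) with h1 | h1 <;> omega

/-- If the walk is extremal in the direction `w` along the side before an excursion and in the
direction `-w` later in this excursion, then it has reached the far end of the side. -/
theorem far_of_isExtremal (h : Run q σ) {a b i : ℕ} {w : ℤ × ℤ} (ha : 1 ≤ a) (hab : a < b)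
    (hi : 2 ≤ i) (hja : (σ a).s.j ≠ i) (hj : ∀ s, a < s → s ≤ b → (σ s).s.j = i)
    (hw : w = (σ (a + 1)).v ∨ w = -(σ (a + 1)).v) (hwa : IsExtremal q a w)
    (hwb : IsExtremal q b (-w)) : (σ b).s ∈ farEnd i := by
  have hj1 := hj (a + 1) (by omega) hab
  obtain ⟨hex, hq⟩ := h.exit_of_j_ne ha (hj1 ▸ hja.symm)
  have hd1 := h.describes (a + 1) (by omega)
  have hL := (h.valid (a + 1) (by omega)).le_L
  have hy : (σ (a + 1)).s.y = 0 := by rw [hex]; rfl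
  have hdot : dot (q (a + 1)) (σ (a + 1)).v = dot (q a) (σ (a + 1)).v := by
    rw [hq, dot_add, hd1.frame.orth, add_zero]
  have hv : (σ b).v = (σ (a + 1)).v :=
    (h.const_of_forall_j_eq (by omega) hab fun s h1 h2 => hj s (by omega) h2).2
  -- The case `w = v` is impossible: at time `a + 1` the walk is at the near end of a side with at
  -- least two sites (here `2 ≤ i` is used), so at time `a` it was not extremal along `v`.
  rcases hw with rfl | rfl
  · obtain ⟨r, hr, h1, -⟩ := hd1.side.surj_Y (dot (q (a + 1)) (σ (a + 1)).v + 1)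
      (by omega) (by omega)
    have hr' : r ≤ a := by
      by_contra hlt
      obtain rfl : r = a + 1 := by omega
      omega
    have := hwa r hr'
    omega
  · rw [neg_neg, ← hv] at hwb
    exact ⟨hj b hab le_rfl, (h.describes b (by omega)).isExtremal_v_iff.1 hwb⟩

end Run

/-! ### The times `T k`, `U k` as the changes of excursion index. -/

/-- A run whose first step is horizontal. -/
structure HorizontalRun (q : Path) (σ : ℕ → State) : Prop extends Run q σ where
  horizontal : (σ 1).u.2 = 0

namespace HorizontalRun

variable {q : Path} {σ : ℕ → State} {t : ℕ}

/-- Each exit turns the frame by a right angle, so even indices are the vertical excursions and odd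
ones the horizontal excursions. -/
theorem parity (h : HorizontalRun q σ) (ht : 1 ≤ t) :
    ((σ t).s.j % 2 = 0 ∧ ((σ t).u = (1, 0) ∨ (σ t).u = (-1, 0)) ∧
        ((σ t).v = (0, 1) ∨ (σ t).v = (0, -1))) ∨
      ((σ t).s.j % 2 = 1 ∧ ((σ t).u = (0, 1) ∨ (σ t).u = (0, -1)) ∧
        ((σ t).v = (1, 0) ∨ (σ t).v = (-1, 0))) := by
  induction t, ht using Nat.le_induction with
  | base =>
    rcases (h.describes 1 le_rfl).frame.cases with hc | ⟨hu, -⟩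
    · left; exact ⟨by simp [h.init], hc⟩
    · have := h.horizontal
      rcases hu with hu | hu <;> rw [hu] at this <;> simp at this
  | succ t ht ih =>
    rcases h.next ht with ⟨h1, -, h2, h3⟩ | ⟨-, h2, -⟩ | ⟨-, h2, -⟩
    · rw [h1, h2, h3]; exact ih
    all_goals
      rw [h2]
      simp only [SideState.exit]
      rcases ih with ⟨h1, h2 | h2, h3 | h3⟩ | ⟨h1, h2 | h2, h3 | h3⟩ <;> rw [h2, h3] <;>
        simp <;> omega

theorem size_of_even (h : HorizontalRun q σ) (ht : 1 ≤ t) (hj : (σ t).s.j % 2 = 0) :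
    width q t = (σ t).s.M ∧ height q t = (σ t).s.L := by
  rcases h.parity ht with ⟨-, hu, hv⟩ | ⟨h1, -⟩
  · rw [State.Describes.width_eq hu, State.Describes.height_eq hv]
    exact ⟨(h.describes t ht).card_u, (h.describes t ht).card_v⟩
  · omega

theorem size_of_odd (h : HorizontalRun q σ) (ht : 1 ≤ t) (hj : (σ t).s.j % 2 = 1) :
    width q t = (σ t).s.L ∧ height q t = (σ t).s.M := by
  rcases h.parity ht with ⟨h1, -⟩ | ⟨-, hu, hv⟩
  · omega
  · rw [State.Describes.height_eq hu, State.Describes.width_eq hv]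
    exact ⟨(h.describes t ht).card_v, (h.describes t ht).card_u⟩

theorem height_succ_of_even (h : HorizontalRun q σ) (ht : 1 ≤ t) (hj : (σ t).s.j % 2 = 0) :
    ((σ (t + 1)).s.j = (σ t).s.j → height q (t + 1) = height q t) ∧
      ((σ (t + 1)).s.j ≠ (σ t).s.j →
        height q (t + 1) = height q t + 1 ∧ width q (t + 1) = width q t) := by
  obtain ⟨h1, h2⟩ := h.size_of_even ht hj
  constructor
  · intro e
    rw [h2, (h.size_of_even (by omega) (by omega)).2]
    exact (h.const_of_j_eq ht e).1
  · intro e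
    have hex := (h.exit_of_j_ne ht e).1
    have hj' : (σ (t + 1)).s.j = (σ t).s.j + 1 := by rw [hex]; rfl
    obtain ⟨h3, h4⟩ := h.size_of_odd (t := t + 1) (by omega) (by omega)
    rw [h1, h2, h3, h4, hex]
    exact ⟨rfl, rfl⟩

theorem width_succ_of_odd (h : HorizontalRun q σ) (ht : 1 ≤ t) (hj : (σ t).s.j % 2 = 1) :
    ((σ (t + 1)).s.j = (σ t).s.j → width q (t + 1) = width q t) ∧
      ((σ (t + 1)).s.j ≠ (σ t).s.j →
        width q (t + 1) = width q t + 1 ∧ height q (t + 1) = height q t) := by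
  obtain ⟨h1, h2⟩ := h.size_of_odd ht hj
  constructor
  · intro e
    rw [h1, (h.size_of_odd (by omega) (by omega)).1]
    exact (h.const_of_j_eq ht e).1
  · intro e
    have hex := (h.exit_of_j_ne ht e).1
    have hj' : (σ (t + 1)).s.j = (σ t).s.j + 1 := by rw [hex]; rfl
    obtain ⟨h3, h4⟩ := h.size_of_even (t := t + 1) (by omega) (by omega)
    rw [h1, h2, h3, h4, hex]
    exact ⟨rfl, rfl⟩

end HorizontalRun

theorem firstTime_eq_coe_sInf {S : Set ℕ} (hS : S.Nonempty) : firstTime S = (sInf S : ℕ) := by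
  refine IsLeast.csInf_eq ⟨⟨_, Nat.sInf_mem hS, rfl⟩, ?_⟩
  rintro _ ⟨t, ht, rfl⟩
  exact Nat.cast_le.2 (Nat.sInf_le ht)

theorem nonempty_of_firstTime_sub_one {S : Set ℕ} {u : ℕ} (h : firstTime S - 1 = (u : ℕ∞)) :
    S.Nonempty := by
  by_contra hS
  rw [Set.not_nonempty_iff_eq_empty] at hS
  subst hS
  simp [firstTime] at h

/-- Excluding 0 makes the truncated subtraction faithful. -/
theorem firstTime_sub_one_eq {S : Set ℕ} {u : ℕ} (h0 : 0 ∉ S)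
    (h : firstTime S - 1 = (u : ℕ∞)) : u + 1 ∈ S ∧ ∀ s ∈ S, u + 1 ≤ s := by
  have hS := nonempty_of_firstTime_sub_one h
  rw [firstTime_eq_coe_sInf hS] at h
  have h1 : sInf S - 1 = u := by exact_mod_cast h
  have hmem := Nat.sInf_mem hS
  have hpos : sInf S ≠ 0 := fun e => h0 (e ▸ hmem)
  have h2 : u + 1 = sInf S := by omega
  rw [h2]
  exact ⟨hmem, fun s hs => Nat.sInf_le hs⟩

/-- Common to both kinds of excursions: `S` is the set of times when the current side grows, which
during excursion `i` happens exactly on exit. The step from `a` to `a + 1` enlarges the other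
dimension, hence `a + 1 ∉ S`. -/
theorem Run.excursion_end {q : Path} {σ : ℕ → State} (h : Run q σ) {S : Set ℕ} {a i u : ℕ}
    (hj : (σ (a + 1)).s.j = i) (hS : ∀ s ∈ S, a < s) (ha : a + 1 ∉ S)
    (hstay : ∀ s, a < s → (σ s).s.j = i → (σ (s + 1)).s.j = (σ s).s.j → s + 1 ∉ S)
    (hexit : ∀ s, a < s → (σ s).s.j = i → (σ (s + 1)).s.j ≠ (σ s).s.j → s + 1 ∈ S)
    (hu : u + 1 ∈ S) (hmin : ∀ s ∈ S, u + 1 ≤ s) :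
    a < u ∧ (∀ s, a < s → s ≤ u → (σ s).s.j = i) ∧ (σ (u + 1)).s.j = i + 1 := by
  have hau : a < u := by
    have h1 := hS _ hu
    have h2 : u ≠ a := fun e => ha (e ▸ hu)
    omega
  have hall : ∀ s, a < s → s ≤ u → (σ s).s.j = i := by
    intro s hs
    induction s, (Nat.succ_le_of_lt hs) using Nat.le_induction with
    | base => exact fun _ => hj
    | succ s hs' ih =>
      intro hsu
      have h1 := ih (by omega) (by omega)
      by_contra hne
      have := hmin _ (hexit s (by omega) h1 (h1.symm ▸ hne))
      omega
  refine ⟨hau, hall, ?_⟩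
  have h1 := hall u hau le_rfl
  rcases h.j_succ (t := u) (by omega) with h2 | h2
  · exact absurd hu (hstay u hau h1 h2)
  · rw [h2, h1]

namespace HorizontalRun

variable {q : Path} {σ : ℕ → State}

theorem timeU_of_timeT (h : HorizontalRun q σ) {k t u : ℕ} (ht : 1 ≤ t)
    (hj : (σ t).s.j = 2 * k + 1) (hj' : (σ (t + 1)).s.j = 2 * k + 2)
    (hT : timeT q (k + 1) = t) (hu : timeU q (k + 1) = u) :
    t < u ∧ (∀ s, t < s → s ≤ u → (σ s).s.j = 2 * k + 2) ∧ (σ (u + 1)).s.j = 2 * k + 3 := by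
  have hU : firstTime {s | timeT q (k + 1) < (s : ℕ∞) ∧ height q (s - 1) < height q s} - 1 =
      (u : ℕ∞) := hu
  rw [hT] at hU
  obtain ⟨h1, h2⟩ := firstTime_sub_one_eq (by simp) hU
  refine h.excursion_end hj' (fun s hs => by exact_mod_cast hs.1) ?_ ?_ ?_ h1 h2
  · rintro ⟨-, h3⟩
    simp only [Nat.add_sub_cancel] at h3
    have := ((h.width_succ_of_odd ht (by omega)).2 (by omega)).2
    omega
  · rintro s hs h3 h4 ⟨-, h5⟩
    simp only [Nat.add_sub_cancel] at h5
    have := (h.height_succ_of_even (t := s) (by omega) (by omega)).1 h4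
    omega
  · intro s hs h3 h4
    refine ⟨by exact_mod_cast (by omega : t < s + 1), ?_⟩
    simp only [Nat.add_sub_cancel]
    have := ((h.height_succ_of_even (t := s) (by omega) (by omega)).2 h4).1
    omega

theorem timeT_of_timeU (h : HorizontalRun q σ) {k t u : ℕ} (hu : 1 ≤ u)
    (hj : (σ u).s.j = 2 * k) (hj' : (σ (u + 1)).s.j = 2 * k + 1)
    (hU : timeU q k = u) (ht : timeT q (k + 1) = t) :
    u < t ∧ (∀ s, u < s → s ≤ t → (σ s).s.j = 2 * k + 1) ∧ (σ (t + 1)).s.j = 2 * k + 2 := by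
  have hT : firstTime {s | timeU q k < (s : ℕ∞) ∧ width q (s - 1) < width q s} - 1 =
      (t : ℕ∞) := ht
  rw [hU] at hT
  obtain ⟨h1, h2⟩ := firstTime_sub_one_eq (by simp) hT
  refine h.excursion_end hj' (fun s hs => by exact_mod_cast hs.1) ?_ ?_ ?_ h1 h2
  · rintro ⟨-, h3⟩
    simp only [Nat.add_sub_cancel] at h3
    have := ((h.height_succ_of_even hu (by omega)).2 (by omega)).2
    omega
  · rintro s hs h3 h4 ⟨-, h5⟩
    simp only [Nat.add_sub_cancel] at h5
    have := (h.width_succ_of_odd (t := s) (by omega) (by omega)).1 h4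
    omega
  · intro s hs h3 h4
    refine ⟨by exact_mod_cast (by omega : u < s + 1), ?_⟩
    simp only [Nat.add_sub_cancel]
    have := ((h.width_succ_of_odd (t := s) (by omega) (by omega)).2 h4).1
    omega

theorem timeU_zero (h : HorizontalRun q σ) {u : ℕ} (hu : timeU q 0 = u) :
    1 ≤ u ∧ (σ u).s.j = 0 ∧ (σ (u + 1)).s.j = 1 := by
  obtain ⟨h1, h2⟩ := firstTime_sub_one_eq (S := {t | 0 < t ∧ 1 < height q t}) (by simp) hu
  have hL : ∀ s, 1 ≤ s → (σ s).s.j = 0 → height q s = 1 := fun s hs hj => by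
    rw [(h.size_of_even hs (by omega)).2, (h.valid s hs).L_eq hj]
  have hj1 : (σ 1).s.j = 0 := by rw [h.init]
  obtain ⟨h3, h4, h5⟩ := h.excursion_end (a := 0) hj1 (fun s hs => hs.1) (by
    rintro ⟨-, h3⟩
    have : height q (0 + 1) = 1 := hL 1 le_rfl hj1
    omega) (by
    rintro s hs h3 h4 ⟨-, h5⟩
    have := hL (s + 1) (by omega) (h4.trans h3)
    omega) (by
    intro s hs h3 h4
    refine ⟨by omega, ?_⟩
    have := ((h.height_succ_of_even (t := s) (by omega) (by omega)).2 h4).1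
    have := hL s hs h3
    omega) h1 h2
  exact ⟨h3, h4 u h3 le_rfl, h5⟩

theorem exists_timeT {k u : ℕ} (hu : timeU q (k + 1) = u) : ∃ t : ℕ, timeT q (k + 1) = t := by
  rcases eq_or_ne (timeT q (k + 1)) ⊤ with hT | hT
  · have hU : firstTime {s | timeT q (k + 1) < (s : ℕ∞) ∧ height q (s - 1) < height q s} - 1 =
      (u : ℕ∞) := hu
    obtain ⟨s, hs, -⟩ := nonempty_of_firstTime_sub_one hU
    rw [hT] at hs
    exact absurd hs not_top_lt
  · obtain ⟨t, ht⟩ := ENat.ne_top_iff_exists.1 hT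
    exact ⟨t, ht.symm⟩

theorem exists_timeU {k t : ℕ} (ht : timeT q (k + 1) = t) : ∃ u : ℕ, timeU q k = u := by
  rcases eq_or_ne (timeU q k) ⊤ with hU | hU
  · have hT : firstTime {s | timeU q k < (s : ℕ∞) ∧ width q (s - 1) < width q s} - 1 =
      (t : ℕ∞) := ht
    obtain ⟨s, hs, -⟩ := nonempty_of_firstTime_sub_one hT
    rw [hU] at hs
    exact absurd hs not_top_lt
  · obtain ⟨u, hu⟩ := ENat.ne_top_iff_exists.1 hU
    exact ⟨u, hu.symm⟩

/-- `U k` is the last time of index `2 * k` and `T (k + 1)` the last time of index `2 * k + 1`,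
whenever they are finite; an infinite time makes all later ones infinite, so the induction only
meets finite ones. -/
theorem times (h : HorizontalRun q σ) (k : ℕ) :
    (∀ u : ℕ, timeU q k = u → 1 ≤ u ∧ (σ u).s.j = 2 * k ∧ (σ (u + 1)).s.j = 2 * k + 1) ∧
      ∀ t : ℕ, timeT q (k + 1) = t →
        1 ≤ t ∧ (σ t).s.j = 2 * k + 1 ∧ (σ (t + 1)).s.j = 2 * k + 2 := by
  have hT : ∀ k, (∀ u : ℕ, timeU q k = u →
      1 ≤ u ∧ (σ u).s.j = 2 * k ∧ (σ (u + 1)).s.j = 2 * k + 1) → ∀ t : ℕ, timeT q (k + 1) = t →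
        1 ≤ t ∧ (σ t).s.j = 2 * k + 1 ∧ (σ (t + 1)).s.j = 2 * k + 2 := by
    intro k hU t ht
    obtain ⟨u, hu⟩ := exists_timeU ht
    obtain ⟨h1, h2, h3⟩ := hU u hu
    obtain ⟨h4, h5, h6⟩ := h.timeT_of_timeU h1 h2 h3 hu ht
    exact ⟨by omega, h5 t h4 le_rfl, h6⟩
  induction k with
  | zero => exact ⟨fun u hu => h.timeU_zero hu, hT 0 fun u hu => h.timeU_zero hu⟩
  | succ k ih =>
    have hU : ∀ u : ℕ, timeU q (k + 1) = u →
        1 ≤ u ∧ (σ u).s.j = 2 * (k + 1) ∧ (σ (u + 1)).s.j = 2 * (k + 1) + 1 := by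
      intro u hu
      obtain ⟨t, ht⟩ := exists_timeT hu
      obtain ⟨h1, h2, h3⟩ := ih.2 t ht
      obtain ⟨h4, h5, h6⟩ := h.timeU_of_timeT h1 h2 h3 ht hu
      exact ⟨by omega, h5 u h4 le_rfl, h6⟩
    exact ⟨hU, hT (k + 1) hU⟩

theorem exists_far_of_crossesVertically (h : HorizontalRun q σ) {k : ℕ}
    (hc : CrossesVertically q (k + 1)) : ∃ t, 1 ≤ t ∧ (σ t).s ∈ farEnd (2 * (k + 1)) := by
  obtain ⟨t, u, ht, hu, b, hb, hb'⟩ := hc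
  obtain ⟨h1, h2, h3⟩ := (h.times k).2 t ht
  obtain ⟨h4, h5, -⟩ := h.timeU_of_timeT h1 h2 h3 ht hu
  refine ⟨u, by omega, h.far_of_isExtremal h1 h4 (by omega) (by omega) h5 ?_ hb.isExtremal ?_⟩
  · rcases h.parity (t := t + 1) (by omega) with ⟨-, -, hv⟩ | ⟨h6, -⟩
    · rcases hv with hv | hv <;> rw [hv] <;> cases b <;> simp [sgn]
    · omega
  · simpa [sgn_not] using hb'.isExtremal

theorem exists_far_of_crossesHorizontally (h : HorizontalRun q σ) {k : ℕ} (hk : 1 ≤ k)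
    (hc : CrossesHorizontally q k) : ∃ t, 1 ≤ t ∧ (σ t).s ∈ farEnd (2 * k + 1) := by
  obtain ⟨u, t, hu, ht, b, hb, hb'⟩ := hc
  obtain ⟨h1, h2, h3⟩ := (h.times k).1 u hu
  obtain ⟨h4, h5, -⟩ := h.timeT_of_timeU h1 h2 h3 hu ht
  refine ⟨t, by omega, h.far_of_isExtremal h1 h4 (by omega) (by omega) h5 ?_ hb.isExtremal ?_⟩
  · rcases h.parity (t := u + 1) (by omega) with ⟨h6, -⟩ | ⟨-, -, hv⟩
    · omega
    · rcases hv with hv | hv <;> rw [hv] <;> cases b <;> simp [sgn]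
  · simpa [sgn_not] using hb'.isExtremal

end HorizontalRun

theorem exists_far_of_crosses {p : Path} (hp : ∀ t, PrudentUpTo p t) {k : ℕ} (hk : 1 ≤ k)
    (hc : CrossesVertically (orient p) k ∨ CrossesHorizontally (orient p) k) :
    ∃ t, 1 ≤ t ∧ ((stateAt p t).s ∈ farEnd (2 * k) ∨ (stateAt p t).s ∈ farEnd (2 * k + 1)) := by
  have hrun := PrudentUpTo.run hp
  have hu : (stateAt p 1).u = p 1 := by simp [stateAt, initState, (hp 0).1]
  have hdir : p 1 ∈ directions := by
    have := (hrun.describes 1 le_rfl).frame.u_mem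
    rwa [hu] at this
  have hmain : ∃ σ : ℕ → State, HorizontalRun (orient p) σ ∧ ∀ t, (σ t).s = (stateAt p t).s := by
    by_cases hv : p 1 = (0, 1) ∨ p 1 = (0, -1)
    · refine ⟨fun t => (stateAt p t).swap, ⟨?_, ?_⟩, fun t => rfl⟩
      · have : orient p = fun t => (p t).swap := by funext t; exact if_pos hv
        rw [this]
        exact hrun.swap
      · simp only [State.swap, hu]
        rcases hv with hv | hv <;> rw [hv] <;> rfl
    · refine ⟨stateAt p, ⟨?_, ?_⟩, fun t => rfl⟩
      · have : orient p = p := by funext t; exact if_neg hv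
        rw [this]
        exact hrun
      · rw [hu]
        simp only [directions, Finset.mem_insert, Finset.mem_singleton] at hdir
        rcases hdir with e | e | e | e
        · rw [e]
        · rw [e]
        · exact absurd (.inl e) hv
        · exact absurd (.inr e) hv
  obtain ⟨σ, hσ, hs⟩ := hmain
  rcases hc with hc | hc
  · obtain ⟨k, rfl⟩ := Nat.exists_eq_add_of_le' hk
    obtain ⟨t, h1, h2⟩ := hσ.exists_far_of_crossesVertically hc
    exact ⟨t, h1, .inl (hs t ▸ h2)⟩
  · obtain ⟨t, h1, h2⟩ := hσ.exists_far_of_crossesHorizontally hk hc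
    exact ⟨t, h1, .inr (hs t ▸ h2)⟩

/-! ### Uniqueness of the corner visited infinitely often. -/

namespace Run

variable {q : Path} {σ : ℕ → State}

theorem exists_le_j (h : Run q σ)
    (hfin : ∀ J L : ℕ, ∀ᶠ t in atTop, ¬ ((σ t).s.j = J ∧ (σ t).s.L = L)) (J : ℕ) :
    ∃ t, 1 ≤ t ∧ J ≤ (σ t).s.j := by
  induction J with
  | zero => exact ⟨1, le_rfl, Nat.zero_le _⟩
  | succ J ih =>
    obtain ⟨t, ht, htJ⟩ := ih
    by_contra! H
    have hj : ∀ s, t ≤ s → (σ s).s.j = J := fun s hs => by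
      have h1 := H s (ht.trans hs)
      have h2 := h.j_mono ht hs
      omega
    obtain ⟨N, hN⟩ := eventually_atTop.1 (hfin J (σ t).s.L)
    refine hN (max N t) (le_max_left _ _) ⟨hj _ (le_max_right _ _), ?_⟩
    exact (h.const_of_forall_j_eq ht (le_max_right N t) fun s h1 _ => hj s h1).1

theorem exists_y_eq_zero (h : Run q σ) {a b : ℕ} (ha : 1 ≤ a) (hab : a ≤ b)
    (hj : (σ b).s.j ≠ (σ a).s.j) : ∃ s, a ≤ s ∧ (σ s).s.y = 0 := by
  induction b, hab using Nat.le_induction with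
  | base => exact absurd rfl hj
  | succ b hab ih =>
    by_cases hb : (σ (b + 1)).s.j = (σ b).s.j
    · exact ih (hb ▸ hj)
    · exact ⟨b + 1, by omega, by rw [(h.exit_of_j_ne (ha.trans hab) hb).1]; rfl⟩

theorem existsUnique_corner (h : Run q σ)
    (hfin : ∀ J L : ℕ, ∀ᶠ t in atTop, ¬ ((σ t).s.j = J ∧ (σ t).s.L = L))
    (hfar : ∀ᶠ J in atTop, ¬ ∃ t, 1 ≤ t ∧ (σ t).s ∈ farEnd J) :
    ∃! c : Corner, ∃ᶠ t in atTop, VisitsCorner q t c := by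
  obtain ⟨J, hJ⟩ := eventually_atTop.1 hfar
  obtain ⟨a, ha, hja⟩ := h.exists_le_j hfin J
  have hnot : ∀ t, a ≤ t → (σ t).s.y + 1 ≠ (σ t).s.L := fun t ht hy =>
    hJ (σ t).s.j (hja.trans (h.j_mono ha ht)) ⟨t, ha.trans ht, rfl, hy⟩
  -- A near exit replaces `(u, v)` by `(-v, -u)`, which preserves `u - v`; far exits no longer occur
  -- after `a`.
  have hlabel : ∀ t, a ≤ t → (σ t).u - (σ t).v = (σ a).u - (σ a).v := by
    intro t ht
    induction t, ht using Nat.le_induction with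
    | base => rfl
    | succ t ht ih =>
      rw [← ih]
      rcases h.next (ha.trans ht) with ⟨-, -, h1, h2⟩ | ⟨h1, -⟩ | ⟨-, h1, -⟩
      · rw [h1, h2]
      · exact absurd h1 (hnot t ht)
      · rw [h1]; simp only; abel
  have hiff : ∀ t, a ≤ t → ∀ c : Corner, VisitsCorner q t c ↔
      (σ t).s.y = 0 ∧ (sgn c.1, sgn c.2) = (σ a).u - (σ a).v := fun t ht c => by
    rw [(h.describes t (ha.trans ht)).visitsCorner_iff_of_not_far (hnot t ht), hlabel t ht]
  obtain ⟨c, hc⟩ : ∃ c : Corner, (sgn c.1, sgn c.2) = (σ a).u - (σ a).v := by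
    rcases (h.describes a ha).frame.cases with ⟨hu | hu, hv | hv⟩ | ⟨hu | hu, hv | hv⟩ <;>
      rw [hu, hv] <;> simp [sgn]
  refine ⟨c, ?_, ?_⟩
  · refine frequently_atTop.2 fun N => ?_
    -- Excursions keep ending, and each new one starts at `y = 0`, hence at the distinguished
    -- corner.
    obtain ⟨b, hb, hjb⟩ := h.exists_le_j hfin ((σ (max N a)).s.j + 1)
    have ha' : 1 ≤ max N a := ha.trans (le_max_right _ _)
    have hab : max N a ≤ b := by
      by_contra! hlt
      have := h.j_mono hb hlt.le
      omega
    obtain ⟨s, hs, hy⟩ := h.exists_y_eq_zero ha' hab (by omega)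
    exact ⟨s, (le_max_left _ _).trans hs, (hiff s ((le_max_right _ _).trans hs) c).2 ⟨hy, hc⟩⟩
  · intro c' hc'
    obtain ⟨t, ht, hv⟩ := frequently_atTop.1 hc' a
    have h1 := ((hiff t ht c').1 hv).2.trans hc.symm
    rw [Prod.ext_iff] at h1
    exact Prod.ext (sgn_injective h1.1) (sgn_injective h1.2)

end Run

/-! ### Summable bounds and conclusion. -/

section Walk

variable {Ω : Type*} [MeasurableSpace Ω] {P : Measure Ω} {γ : ℕ → Ω → ℤ × ℤ}

/-- The event that the far end of the side is reached during the excursion number `J`. -/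
def reachesFarEnd (γ : ℕ → Ω → ℤ × ℤ) (J : ℕ) : Set Ω :=
  {ω | ∃ t, 1 ≤ t ∧ (stateAt (fun s => γ s ω) t).s ∈ farEnd J}

theorem IsPrudentWalk.crossing_ae_le (hγ : IsPrudentWalk P γ) {k : ℕ} (hk : 1 ≤ k) :
    crossing γ k ≤ᵐ[P] (reachesFarEnd γ (2 * k) ∪ reachesFarEnd γ (2 * k + 1) : Set Ω) := by
  filter_upwards [hγ.ae_prudent] with ω hω hc
  obtain ⟨t, h1, h2 | h2⟩ := exists_far_of_crosses hω hk hc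
  exacts [.inl ⟨t, h1, h2⟩, .inr ⟨t, h1, h2⟩]

end Walk

theorem exists_measure_reachesFarEnd_le : ∃ C : ℝ, 0 < C ∧
    ∀ {Ω : Type*} [MeasurableSpace Ω] (P : Measure Ω) [IsProbabilityMeasure P]
      (γ : ℕ → Ω → ℤ × ℤ), IsPrudentWalk P γ → ∀ J : ℕ, 512 ≤ J →
        P (reachesFarEnd γ J) ≤ ENNReal.ofReal (C / (J : ℝ) ^ ((4 : ℝ) / 3)) := by
  obtain ⟨C, hC, h⟩ := exists_farEnd_bound
  refine ⟨C, hC, fun P _ γ hγ J hJ => ?_⟩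
  obtain ⟨m, h1, h2, h3⟩ := h J hJ
  exact (hγ.measure_farEnd_le h1 h2).trans (ENNReal.ofReal_le_ofReal h3)

theorem tsum_measure_ne_top {Ω : Type*} [MeasurableSpace Ω] {P : Measure Ω}
    [IsProbabilityMeasure P] {A : ℕ → Set Ω} {C : ℝ} {K : ℕ}
    (h : ∀ k, K ≤ k → P (A k) ≤ ENNReal.ofReal (C / (k : ℝ) ^ ((4 : ℝ) / 3))) :
    ∑' k, P (A k) ≠ ⊤ := by
  have hs : Summable fun k : ℕ => |C / (k : ℝ) ^ ((4 : ℝ) / 3)| := by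
    have := (Real.summable_one_div_nat_rpow (p := (4 : ℝ) / 3)).2 (by norm_num)
    refine (this.mul_left C).abs.congr fun k => ?_
    rw [mul_one_div]
  rw [← ENNReal.summable.sum_add_tsum_nat_add' (f := fun k => P (A k)) (k := K)]
  refine ENNReal.add_ne_top.2 ⟨ENNReal.sum_ne_top.2 fun k _ => measure_ne_top P _, ?_⟩
  refine ne_top_of_le_ne_top ((summable_nat_add_iff K).2 hs).tsum_ofReal_ne_top
    (ENNReal.tsum_le_tsum fun k => ?_)
  exact (h (k + K) (Nat.le_add_left K k)).trans (ENNReal.ofReal_le_ofReal (le_abs_self _))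

end PrudentWalk

theorem proposition1 :
    ∃ (C : ℝ) (K : ℕ), 0 < C ∧
      ∀ {Ω : Type*} [MeasurableSpace Ω] (P : Measure Ω) [IsProbabilityMeasure P]
        (γ : ℕ → Ω → ℤ × ℤ), PrudentWalk.IsPrudentWalk P γ →
        (∀ k : ℕ, K ≤ k →
          P.real (PrudentWalk.crossing γ k) ≤ C / (k : ℝ) ^ ((4 : ℝ) / 3)) ∧
        P (limsup (PrudentWalk.crossing γ) atTop) = 0 ∧
        (∀ᵐ ω ∂P, ∃! c : PrudentWalk.Corner,
          ∃ᶠ t in atTop, PrudentWalk.VisitsCorner (fun s => γ s ω) t c) := by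
  obtain ⟨C, hC, hfar⟩ := PrudentWalk.exists_measure_reachesFarEnd_le
  refine ⟨2 * C, 512, by positivity, fun P _ γ hγ => ?_⟩
  have hbound : ∀ k : ℕ, 512 ≤ k → P (PrudentWalk.crossing γ k) ≤
      ENNReal.ofReal (2 * C / (k : ℝ) ^ ((4 : ℝ) / 3)) := by
    intro k hk
    have hk0 : (0 : ℝ) < k := by exact_mod_cast (by omega : 0 < k)
    have hle : ∀ J : ℕ, k ≤ J → P (PrudentWalk.reachesFarEnd γ J) ≤
        ENNReal.ofReal (C / (k : ℝ) ^ ((4 : ℝ) / 3)) := by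
      -- Both indices `2 * k` and `2 * k + 1` are at least `k`, so the bound in `J` may be weakened
      -- to one in `k`.
      intro J hJ
      refine (hfar P γ hγ J (hk.trans hJ)).trans (ENNReal.ofReal_le_ofReal ?_)
      gcongr
    refine (measure_mono_ae (hγ.crossing_ae_le (by omega))).trans
      ((measure_union_le _ _).trans ?_)
    refine (add_le_add (hle _ (by omega)) (hle _ (by omega))).trans ?_
    rw [← ENNReal.ofReal_add (by positivity) (by positivity)]
    exact ENNReal.ofReal_le_ofReal (by rw [mul_div_assoc, two_mul])
  refine ⟨fun k hk => ?_, measure_limsup_atTop_eq_zero (PrudentWalk.tsum_measure_ne_top hbound), ?_⟩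
  · exact ENNReal.toReal_le_of_le_ofReal (by positivity) (hbound k hk)
  · filter_upwards [hγ.ae_prudent, hγ.ae_forall_eventually_leave,
      ae_eventually_notMem (PrudentWalk.tsum_measure_ne_top (hfar P γ hγ))] with ω h1 h2 h3
    exact (PrudentWalk.PrudentUpTo.run h1).existsUnique_corner h2 h3
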